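/- All linear spaces are over $\mathbb R$. For non-empty subsets $A,B$ of a Banach space $X$ put $d_H(A,B)=\max\{\sup_{a\in A}\mathrm{dist}(a,B),\sup_{b\in B}\mathrm{dist}(b,A)\}\in[0,\infty]$, where $\mathrm{dist}(a,B)=\inf_{b\in B}\|a-b\|$. A subset of $X$ is polyhedral if it is the intersection of a finite (possibly empty) family of closed half-spaces $f^{-1}([a,+\infty))$, where $f:X\to\mathbb R$ is a non-zero continuous linear functional and $a\in\mathbb R$. A convex set $C\subset X$ is called - approximatively polyhedral if for every $\varepsilon>0$ there is a non-empty polyhedral set $P\subset X$ with $d_H(C,P)<\varepsilon$; - positively hiding (respectively infinitely hiding) if there is an infinite set $A\subset X\setminus C$ such that for any distinct $a,b\in A$ the segment $[a,b]$ meets $C$, and $\inf_{a\in A}\mathrm{dist}(a,C)>0$ (respectively $\sup_{a\in A}\mathrm{dist}(a,C)=\infty$). The characteristic cone of $C$ is $V_C=\{v\in X: c+tv\in C\text{ for all }c\in C,\ t\ge 0\}$. The density of a topological space is the least cardinality of a dense subset, and a space is separable if it has a countable dense subset. **Theorem.** Let $C$ be a non-empty closed convex subset of a Banach space $X$, and let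 $\mathcal H_C$ be the set of all non-empty closed convex sets $A\subset X$ with $d_H(A,C)<\infty$, endowed with the metric $d_H$. The following conditions are equivalent: 1. $C$ is approximatively polyhedral; 2. the characteristic cone $V_C$ is polyhedral in $X$ and $d_H(C,V_C)<\infty$; 3. $\mathcal H_C$ contains a polyhedral set; 4. $\mathcal H_C$ contains no positively hiding set; 5. $\mathcal H_C$ is separable; 6. the density of $\mathcal H_C$ is less than $\mathfrak c$, the cardinality of the continuum. If $X$ is finite-dimensional, then conditions (1)–(6) are also equivalent to each of the following: 7. $C$ is not positively hiding; 8. $C$ is not infinitely hiding. -/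

import Mathlib

open TopologicalSpace

section Polyhedral

variable {X : Type*} [NormedAddCommGroup X] [NormedSpace ℝ X]

/-- A closed half-space `f⁻¹([a, +∞))`, with `f` a non-zero continuous linear functional. -/
def IsClosedHalfSpace (H : Set X) : Prop :=
  ∃ f : X →L[ℝ] ℝ, f ≠ 0 ∧ ∃ a : ℝ, H = f ⁻¹' Set.Ici a

/-- A polyhedral set: the intersection of a finite (possibly empty) family of closed half-spaces. -/
def IsPolyhedral (P : Set X) : Prop :=
  ∃ F : Set (Set X), F.Finite ∧ (∀ H ∈ F, IsClosedHalfSpace H) ∧ P = ⋂₀ F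

/-- Approximatively polyhedral sets. The Hausdorff distance takes values in `[0, ∞]`, and it is
infinite between the empty set and a non-empty set. -/
def IsApproxPolyhedral (C : Set X) : Prop :=
  ∀ ε : ℝ, 0 < ε → ∃ P : Set X, IsPolyhedral P ∧ Metric.hausdorffEDist C P < ENNReal.ofReal ε

/-- The characteristic cone `V_C`: all `v` such that every ray `c + [0, ∞) v`, `c ∈ C`,
lies in `C`. -/
def characteristicCone (C : Set X) : Set X :=
  {v | ∀ c ∈ C, ∀ t : ℝ, 0 ≤ t → c + t • v ∈ C}

/-- `C` hides `A`: for any two distinct points of `A` the segment joining them meets `C`. -/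
def Hides (C A : Set X) : Prop :=
  ∀ a ∈ A, ∀ b ∈ A, a ≠ b → (segment ℝ a b ∩ C).Nonempty

/-- `C` hides an infinite set `A ⊆ X \ C` with `inf_{a ∈ A} dist(a, C) > 0`. -/
def IsPositivelyHiding (C : Set X) : Prop :=
  ∃ A : Set X, A.Infinite ∧ A ⊆ Cᶜ ∧ Hides C A ∧ 0 < ⨅ a ∈ A, Metric.infEDist a C

/-- `C` hides an infinite set `A ⊆ X \ C` with `sup_{a ∈ A} dist(a, C) = ∞`. -/
def IsInfinitelyHiding (C : Set X) : Prop :=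
  ∃ A : Set X, A.Infinite ∧ A ⊆ Cᶜ ∧ Hides C A ∧ ⨆ a ∈ A, Metric.infEDist a C = ⊤

end Polyhedral

/-- The space of non-empty closed convex subsets of `X`. As a subtype of `Closeds X` it carries the
extended metric `edist A B = Metric.hausdorffEDist A B` and the topology of that metric. -/
abbrev ConvH (X : Type*) [NormedAddCommGroup X] [NormedSpace ℝ X] : Type _ :=
  {A : Closeds X // (A : Set X).Nonempty ∧ Convex ℝ (A : Set X)}

/-- The Hausdorff metric component of `C`: the non-empty closed convex sets at finite Hausdorff
distance from `C`. -/
def hausdorffComponent {X : Type*} [NormedAddCommGroup X] [NormedSpace ℝ X] (C : Set X) :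
    Set (ConvH X) :=
  {A | Metric.hausdorffEDist (A.1 : Set X) C < ⊤}

/-- The density of a topological space: the least cardinality of a dense subset. -/
noncomputable def topologicalDensity (Y : Type*) [TopologicalSpace Y] : Cardinal :=
  ⨅ D : {D : Set Y // Dense D}, Cardinal.mk D.1

/-!
The properties of a convex set near a polyhedral one rest on one finiteness statement for a cone
`V = {v | ∀ i, 0 ≤ f i v}` cut out by finitely many functionals: a set on which all `f i` are bounded
below is, up to a small error, contained in `F + V` for a finite set `F` of its points
(`exists_finite_dominating`). One consequence is a Hoffman bound (`exists_hoffman_bound`), by which a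
polyhedral set is at a finite distance from its characteristic cone, and so is every closed convex
set near it. A closed convex set near `V` is then approximated by `conv F + V`, which is polyhedral by
Fourier-Motzkin elimination (`isPolyhedral_convexHull_add`); letting `F` run over the finite subsets
of a countable set that is dense modulo the lineality space of `V` gives separability
(`separableSpace_hausdorffComponent`).

A positively hiding set `P` makes the density large (`continuum_le_topologicalDensity`): after moving
the hidden points `a n` towards `P`, each of them is separated from `P`, and, since `P` meets the
segments between them, from all the other points as well. Adding to `P` the points indexed by
`J ⊆ ℕ` gives a uniformly discrete family of continuum many sets.

It remains to find hiding sets when the characteristic cone `V` of `C` is not polyhedral or is at an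
infinite distance from `C`. This is governed by the set `dualSphere V` of the functionals of norm one
that are non-negative on `V`.

* If `dualSphere V` is norm compact, then `V` is polyhedral and near `C`, or `C` is infinitely hiding
  (`polyhedral_or_isInfinitelyHiding`). Compactness gives `V` an interior point in its closed linear
  span, and that span is the common kernel of finitely many functionals. If `V` is not
  polyhedral, then the weak-* compact base of its dual cone has infinitely many extreme points; slices
  of the base at these points correspond to points hidden by `V` (`exists_hidden_seq_of_interior`),
  which far away become points hidden by `C`. If `V` is polyhedral but some `f i` is not bounded below
  on `C`, then the problem descends to a finite-dimensional quotient, where some plane section of `C`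
  grows like a parabola and hides a sequence of points (`isInfinitelyHiding_of_not_bddBelow`).
* If the functionals of norm one that are bounded below on `C` form a totally bounded set, then
  `dualSphere V` is compact, because these functionals are weak-* dense in the dual cone
  (`isCompact_dualSphere_of_totallyBounded`). Otherwise they contain an almost biorthogonal sequence,
  and pushing points out of `C` along the dual vectors yields a positively hiding set near `C`
  (`exists_isPositivelyHiding_of_not_totallyBounded`).

In finite dimension `dualSphere V` is always compact, and so `C` itself is hiding unless `V` is
polyhedral and near `C`.
-/

namespace HiddenPolyhedra

open Set Filter Topology
open scoped Pointwise

section Basics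

variable {X : Type*} [NormedAddCommGroup X]

/-! ### Polyhedral sets, Hausdorff distance and characteristic cones -/

theorem hausdorffEDist_le_ofReal {A B : Set X} {R : ℝ}
    (h₁ : ∀ a ∈ A, ∃ b ∈ B, ‖a - b‖ ≤ R) (h₂ : ∀ b ∈ B, ∃ a ∈ A, ‖b - a‖ ≤ R) :
    Metric.hausdorffEDist A B ≤ ENNReal.ofReal R := by
  refine Metric.hausdorffEDist_le_of_mem_edist ?_ ?_
  · intro a ha
    obtain ⟨b, hb, h⟩ := h₁ a ha
    exact ⟨b, hb, by rw [edist_dist, dist_eq_norm]; exact ENNReal.ofReal_le_ofReal h⟩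
  · intro a ha
    obtain ⟨b, hb, h⟩ := h₂ a ha
    exact ⟨b, hb, by rw [edist_dist, dist_eq_norm]; exact ENNReal.ofReal_le_ofReal h⟩

theorem exists_norm_sub_lt_of_hausdorffEDist_lt {A B : Set X} {R : ℝ}
    (h : Metric.hausdorffEDist A B < ENNReal.ofReal R) :
    ∀ a ∈ A, ∃ b ∈ B, ‖a - b‖ < R := by
  intro a ha
  obtain ⟨b, hb, hab⟩ := Metric.exists_edist_lt_of_hausdorffEDist_lt ha h
  rw [edist_dist, dist_eq_norm] at hab
  exact ⟨b, hb, (ENNReal.ofReal_lt_ofReal_iff_of_nonneg (norm_nonneg _)).1 hab⟩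

theorem exists_radius_of_hausdorffEDist_lt_top {A B : Set X}
    (h : Metric.hausdorffEDist A B < ⊤) :
    ∃ R : ℝ, 0 < R ∧ (∀ a ∈ A, ∃ b ∈ B, ‖a - b‖ ≤ R) ∧ ∀ b ∈ B, ∃ a ∈ A, ‖b - a‖ ≤ R := by
  have h' : Metric.hausdorffEDist A B <
      ENNReal.ofReal ((Metric.hausdorffEDist A B).toReal + 1) := by
    rw [ENNReal.lt_ofReal_iff_toReal_lt h.ne]
    linarith
  refine ⟨(Metric.hausdorffEDist A B).toReal + 1, by positivity, fun a ha => ?_, fun b hb => ?_⟩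
  · obtain ⟨b, hb, h⟩ := exists_norm_sub_lt_of_hausdorffEDist_lt h' a ha
    exact ⟨b, hb, h.le⟩
  · rw [Metric.hausdorffEDist_comm] at h'
    obtain ⟨a, ha, h⟩ := exists_norm_sub_lt_of_hausdorffEDist_lt h' b hb
    rw [Metric.hausdorffEDist_comm] at h
    exact ⟨a, ha, h.le⟩

variable [NormedSpace ℝ X]

theorem isPolyhedral_of_nonempty {ι : Type*} [Finite ι] (f : ι → X →L[ℝ] ℝ) (a : ι → ℝ)
    (h : {x | ∀ i, a i ≤ f i x}.Nonempty) : IsPolyhedral {x | ∀ i, a i ≤ f i x} := by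
  refine ⟨(fun i => f i ⁻¹' Ici (a i)) '' {i | f i ≠ 0}, (Set.toFinite _).image _, ?_, ?_⟩
  · rintro _ ⟨i, hi, rfl⟩
    exact ⟨f i, hi, a i, rfl⟩
  · obtain ⟨y, hy⟩ := h
    ext x
    simp only [mem_ofPred_eq, mem_sInter, mem_image, forall_exists_index, and_imp,
      forall_apply_eq_imp_iff₂, mem_preimage, mem_Ici]
    refine ⟨fun hx i _ => hx i, fun hx i => ?_⟩
    by_cases hi : f i = 0
    · have := hy i
      simpa [hi] using! this
    · exact hx i hi

theorem _root_.IsPolyhedral.exists_eq {P : Set X} (hP : IsPolyhedral P) :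
    ∃ (n : ℕ) (f : Fin n → X →L[ℝ] ℝ) (a : Fin n → ℝ), P = {x | ∀ i, a i ≤ f i x} := by
  obtain ⟨F, hF, hH, rfl⟩ := hP
  have : ∀ H : F, ∃ f : X →L[ℝ] ℝ, ∃ a : ℝ, (H : Set X) = f ⁻¹' Ici a := fun H => by
    obtain ⟨f, -, a, h⟩ := hH H H.2
    exact ⟨f, a, h⟩
  choose f a hfa using this
  have := hF.to_subtype
  obtain ⟨n, ⟨e⟩⟩ := Finite.exists_equiv_fin F
  refine ⟨n, fun i => f (e.symm i), fun i => a (e.symm i), ?_⟩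
  ext x
  simp only [mem_sInter, mem_ofPred_eq]
  constructor
  · intro h i
    have := h _ (e.symm i).2
    rw [hfa] at this
    exact this
  · intro h H hHF
    have := h (e ⟨H, hHF⟩)
    rw [e.symm_apply_apply] at this
    have h2 := hfa ⟨H, hHF⟩
    simp only at h2
    rw [h2]
    exact this

theorem _root_.IsPolyhedral.isClosed {P : Set X} (hP : IsPolyhedral P) : IsClosed P := by
  obtain ⟨n, f, a, rfl⟩ := hP.exists_eq
  simp only [ofPred_forall]
  exact isClosed_iInter fun i => isClosed_le continuous_const (f i).continuous

theorem _root_.IsPolyhedral.convex {P : Set X} (hP : IsPolyhedral P) : Convex ℝ P := by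
  obtain ⟨n, f, a, rfl⟩ := hP.exists_eq
  simp only [ofPred_forall]
  exact convex_iInter fun i => convex_halfSpace_ge (f i).isLinear _

theorem mem_hausdorffComponent_iff {C : Set X} {A : ConvH X} :
    A ∈ hausdorffComponent C ↔ Metric.hausdorffEDist (A.1 : Set X) C < ⊤ := Iff.rfl

theorem zero_mem_characteristicCone (C : Set X) : (0 : X) ∈ characteristicCone C := by
  intro c hc t _
  simpa using hc

theorem add_mem_characteristicCone {C : Set X} {v w : X} (hv : v ∈ characteristicCone C)
    (hw : w ∈ characteristicCone C) : v + w ∈ characteristicCone C := by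
  intro c hc t ht
  rw [smul_add, ← add_assoc]
  exact hw _ (hv c hc t ht) t ht

theorem smul_mem_characteristicCone {C : Set X} {v : X} (hv : v ∈ characteristicCone C)
    {s : ℝ} (hs : 0 ≤ s) : s • v ∈ characteristicCone C := by
  intro c hc t ht
  rw [smul_smul]
  exact hv c hc _ (mul_nonneg ht hs)

theorem add_mem_of_mem_characteristicCone {C : Set X} {c v : X} (hc : c ∈ C)
    (hv : v ∈ characteristicCone C) : c + v ∈ C := by
  simpa using hv c hc 1 zero_le_one

theorem isClosed_characteristicCone {C : Set X} (hC : IsClosed C) :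
    IsClosed (characteristicCone C) := by
  have : characteristicCone C =
      ⋂ c ∈ C, ⋂ t : ℝ, ⋂ (_ : 0 ≤ t), {v | c + t • v ∈ C} := by
    ext v
    simp [characteristicCone]
  rw [this]
  refine isClosed_biInter fun c _ => isClosed_iInter fun t => isClosed_iInter fun _ => ?_
  exact hC.preimage (by fun_prop : Continuous fun v : X => c + t • v)

theorem convex_characteristicCone (C : Set X) : Convex ℝ (characteristicCone C) := by
  intro v hv w hw a b ha hb _
  exact add_mem_characteristicCone (smul_mem_characteristicCone hv ha)
    (smul_mem_characteristicCone hw hb)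

/-- A direction whose ray stays within a bounded distance of a closed convex set belongs to the
characteristic cone. -/
theorem mem_characteristicCone_of_near {C : Set X} (hcl : IsClosed C) (hconv : Convex ℝ C)
    {x v : X} {R : ℝ} (h : ∀ t : ℝ, 0 ≤ t → ∃ y ∈ C, ‖x + t • v - y‖ ≤ R) :
    v ∈ characteristicCone C := by
  intro c hc s hs
  rcases hs.eq_or_lt with rfl | hs
  · simpa using hc
  choose! y hyC hy using h
  -- `c + s v` is the limit of the points dividing `[c, y t]` in the ratio `s : t - s`.
  have key : Tendsto (fun n : ℝ => (1 - s / n) • c + (s / n) • y n) atTop (𝓝 (c + s • v)) := by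
    rw [tendsto_iff_norm_sub_tendsto_zero]
    have hlim : Tendsto (fun n : ℝ => (s / n) * (‖x - c‖ + R)) atTop (𝓝 0) := by
      have : Tendsto (fun n : ℝ => s / n) atTop (𝓝 0) := tendsto_const_nhds.div_atTop tendsto_id
      simpa using this.mul_const (‖x - c‖ + R)
    refine squeeze_zero' (Eventually.of_forall fun _ => norm_nonneg _) ?_ hlim
    filter_upwards [eventually_gt_atTop 0] with n hn
    have e : (1 - s / n) • c + (s / n) • y n - (c + s • v)
        = (s / n) • ((x - c) - (x + n • v - y n)) := by
      have : s • v = (s / n) • (n • v) := by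
        rw [smul_smul, div_mul_cancel₀ _ hn.ne']
      rw [this]
      module
    rw [e, norm_smul, Real.norm_of_nonneg (by positivity)]
    gcongr
    exact (norm_sub_le _ _).trans (by gcongr; exact hy n hn.le)
  refine hcl.mem_of_tendsto key ?_
  filter_upwards [eventually_ge_atTop s] with n hn
  have hn0 : 0 < n := hs.trans_le hn
  refine hconv hc (hyC n hn0.le) ?_ (by positivity) (by ring)
  rw [sub_nonneg, div_le_one hn0]
  exact hn

theorem hausdorffEDist_lt_top_of_subset_characteristicCone {C V : Set X} (hC : C.Nonempty)
    (hV : V ⊆ characteristicCone C) {R : ℝ} (h : ∀ c ∈ C, ∃ v ∈ V, ‖c - v‖ ≤ R) :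
    Metric.hausdorffEDist C V < ⊤ := by
  obtain ⟨c₀, hc₀⟩ := hC
  refine (hausdorffEDist_le_ofReal (R := max R ‖c₀‖) (fun c hc => ?_) fun v hv => ?_).trans_lt
    ENNReal.ofReal_lt_top
  · obtain ⟨v, hv, h⟩ := h c hc
    exact ⟨v, hv, h.trans (le_max_left _ _)⟩
  · refine ⟨c₀ + v, add_mem_of_mem_characteristicCone hc₀ (hV hv), ?_⟩
    rw [sub_add_cancel_right, norm_neg]
    exact le_max_right _ _

/-- A closed convex set at a finite distance from a closed convex cone `V` has `V` as its
characteristic cone. -/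
theorem characteristicCone_eq_of_near {C V : Set X} (hcl : IsClosed C) (hconv : Convex ℝ C)
    (hne : C.Nonempty) (hVcl : IsClosed V) (hVconv : Convex ℝ V)
    (hV : ∀ v ∈ V, ∀ t : ℝ, 0 ≤ t → t • v ∈ V)
    {R : ℝ} (h₁ : ∀ c ∈ C, ∃ v ∈ V, ‖c - v‖ ≤ R) (h₂ : ∀ v ∈ V, ∃ c ∈ C, ‖v - c‖ ≤ R) :
    characteristicCone C = V := by
  obtain ⟨c₀, hc₀⟩ := hne
  have hV0 : (0 : X) ∈ V := by
    obtain ⟨v, hv, -⟩ := h₁ c₀ hc₀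
    simpa using hV v hv 0 le_rfl
  refine Subset.antisymm (fun v hv => ?_) fun v hv => ?_
  · have : v ∈ characteristicCone V :=
      mem_characteristicCone_of_near hVcl hVconv (x := c₀) (R := R) fun t ht => h₁ _ (hv c₀ hc₀ t ht)
    simpa using add_mem_of_mem_characteristicCone hV0 this
  · refine mem_characteristicCone_of_near hcl hconv (x := 0) (R := R) fun t ht => ?_
    simpa using h₂ _ (hV v hv t ht)

end Basics

section Hoffman

variable {X : Type*} [NormedAddCommGroup X] [NormedSpace ℝ X]

/-! ### Finite systems of linear inequalities -/

/-- The joint values of finitely many functionals can be lifted with a linear norm bound. -/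
theorem exists_lift_bound {ι : Type*} [Fintype ι] (f : ι → X →L[ℝ] ℝ) :
    ∃ K : ℝ, 0 < K ∧ ∀ x : X, ∃ u : X, (∀ i, f i u = f i x) ∧ ‖u‖ ≤ K * ‖fun i => f i x‖ := by
  let G : X →L[ℝ] (ι → ℝ) := ContinuousLinearMap.pi f
  obtain ⟨s, hs⟩ := G.toLinearMap.rangeRestrict.exists_rightInverse_of_surjective
    (LinearMap.range_eq_top.2 G.toLinearMap.surjective_rangeRestrict)
  let S := LinearMap.toContinuousLinearMap s
  refine ⟨‖S‖ + 1, by positivity, fun x => ⟨S (G.toLinearMap.rangeRestrict x), fun i => ?_, ?_⟩⟩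
  · have h : G.toLinearMap.rangeRestrict (s (G.toLinearMap.rangeRestrict x)) =
        G.toLinearMap.rangeRestrict x := LinearMap.congr_fun hs _
    have h' := congrArg Subtype.val h
    exact congrFun h' i
  · calc ‖S (G.toLinearMap.rangeRestrict x)‖ ≤ ‖S‖ * ‖G.toLinearMap.rangeRestrict x‖ :=
        S.le_opNorm _
      _ ≤ (‖S‖ + 1) * ‖G.toLinearMap.rangeRestrict x‖ := by gcongr; linarith
      _ = _ := rfl

/-- A well-quasi-order property of the preorder defined by finitely many functionals: up to a
small error, a set on which the functionals are bounded below is dominated by finitely many of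
its points. Along a subsequence each functional converges or tends to `+∞`; the errors in the
convergent coordinates are corrected by a lift of small norm. -/
theorem exists_finite_dominating {ι : Type*} [Fintype ι] (f : ι → X →L[ℝ] ℝ) {S : Set X} {a : ℝ}
    (ha : ∀ x ∈ S, ∀ i, a ≤ f i x) {ε : ℝ} (hε : 0 < ε) :
    ∃ F : Finset X, ↑F ⊆ S ∧ ∀ x ∈ S, ∃ c ∈ F, ∃ v, (∀ i, 0 ≤ f i v) ∧ ‖x - c - v‖ ≤ ε := by
  by_contra! hcon
  obtain ⟨c, hcS, hc⟩ := exists_seq_of_forall_finset_exists (fun x : X => x ∈ S)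
    (fun c x => ∀ v, (∀ i, 0 ≤ f i v) → ε < ‖x - c - v‖) (fun F hF => by
      obtain ⟨x, hx, h⟩ := hcon F (fun y hy => hF y hy)
      exact ⟨x, hx, fun c hc v hv => h c hc v hv⟩)
  obtain ⟨l, φ, hφ, hl⟩ := CompactSpace.tendsto_subseq
    (fun n => (fun i => ((f i (c n) : ℝ) : EReal)))
  rw [tendsto_pi_nhds] at hl
  have hal : ∀ i, (a : EReal) ≤ l i := fun i =>
    ge_of_tendsto' (hl i) fun n => EReal.coe_le_coe_iff.2 (ha _ (hcS _) i)
  let I := {i : ι // l i ≠ ⊤}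
  classical
  obtain ⟨K, hK, hlift⟩ := exists_lift_bound (fun i : I => f i)
  have hlreal : ∀ i : I, Tendsto (fun n => f i (c (φ n))) atTop (𝓝 (l i).toReal) := by
    intro i
    have h1 : l i = (((l i).toReal : ℝ) : EReal) :=
      (EReal.coe_toReal i.2 (fun h => by
        have := hal i; rw [h] at this; exact absurd (le_bot_iff.1 this) (EReal.coe_ne_bot a))).symm
    have h2 := hl i
    rw [h1] at h2
    exact EReal.tendsto_coe.1 h2
  set δ : ℝ := ε / (2 * K) with hδ
  have hδ0 : 0 < δ := by positivity
  have hev : ∀ᶠ n in atTop, ∀ i : I, |f i (c (φ n)) - (l i).toReal| < δ := by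
    rw [eventually_all]
    intro i
    have := (hlreal i).eventually (Metric.ball_mem_nhds _ hδ0)
    filter_upwards [this] with n hn
    rwa [← Real.dist_eq]
  obtain ⟨n, hn⟩ := hev.exists
  have hbig : ∀ i : ι, l i = ⊤ → ∀ M : ℝ, ∀ᶠ m in atTop, M ≤ f i (c (φ m)) := by
    intro i hi M
    have h2 := hl i
    rw [hi] at h2
    have := (EReal.tendsto_nhds_top_iff_real.1 h2) M
    filter_upwards [this] with m hm
    exact (EReal.coe_lt_coe_iff.1 hm).le
  have hbig' : ∀ᶠ m in atTop, ∀ i : ι, l i = ⊤ → f i (c (φ n)) + ‖f i‖ * ε ≤ f i (c (φ m)) := by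
    rw [eventually_all]
    intro i
    by_cases hi : l i = ⊤
    · filter_upwards [hbig i hi (f i (c (φ n)) + ‖f i‖ * ε)] with m hm _ using hm
    · exact Eventually.of_forall fun m h => absurd h hi
  obtain ⟨m, ⟨hm1, hm2⟩, hnm⟩ := ((hev.and hbig').and (eventually_gt_atTop n)).exists
  obtain ⟨u, hu, hun⟩ := hlift (c (φ m) - c (φ n))
  have hun' : ‖u‖ ≤ ε := by
    refine hun.trans ?_
    have : ‖fun i : I => f i (c (φ m) - c (φ n))‖ ≤ 2 * δ := by
      refine (pi_norm_le_iff_of_nonneg (by positivity)).2 fun i => ?_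
      rw [map_sub, Real.norm_eq_abs]
      have h1 := abs_lt.1 (hm1 i)
      have h2 := abs_lt.1 (hn i)
      rw [abs_le]
      constructor <;> linarith
    calc K * _ ≤ K * (2 * δ) := by gcongr
      _ = ε := by rw [hδ]; field_simp
  refine absurd (hc (φ n) (φ m) (hφ hnm) (c (φ m) - c (φ n) - u) fun i => ?_) ?_
  · by_cases hi : l i = ⊤
    · have h1 := hm2 i hi
      have h2 : f i u ≤ ‖f i‖ * ε :=
        (le_abs_self _).trans (((f i).le_opNorm u).trans (by gcongr))
      simp only [map_sub]
      linarith
    · have := hu ⟨i, hi⟩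
      simp only [map_sub] at this ⊢
      linarith
  · rw [not_lt, sub_sub_cancel]
    exact hun'

/-- Hoffman's lemma: points violating finitely many homogeneous inequalities by a bounded amount
lie within a bounded distance of the solution cone. -/
theorem exists_hoffman_bound {ι : Type*} [Fintype ι] (f : ι → X →L[ℝ] ℝ) (a : ℝ) :
    ∃ R : ℝ, ∀ x, (∀ i, a ≤ f i x) → ∃ v, (∀ i, 0 ≤ f i v) ∧ ‖x - v‖ ≤ R := by
  obtain ⟨F, -, hF⟩ := exists_finite_dominating f (S := {x | ∀ i, a ≤ f i x})
    (fun x hx => hx) one_pos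
  obtain ⟨R, hR⟩ := (F.finite_toSet.image (fun c => ‖c‖)).bddAbove
  refine ⟨1 + R, fun x hx => ?_⟩
  obtain ⟨c, hc, v, hv, h⟩ := hF x hx
  refine ⟨v, hv, ?_⟩
  calc ‖x - v‖ = ‖(x - c - v) + c‖ := by congr 1; abel
    _ ≤ ‖x - c - v‖ + ‖c‖ := norm_add_le _ _
    _ ≤ 1 + R := add_le_add h (hR ⟨c, hc, rfl⟩)

end Hoffman

section FourierMotzkin

/-! ### Fourier–Motzkin elimination -/

/-- Fourier–Motzkin elimination: adding a ray to a cone defined by finitely many linear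
inequalities gives a cone of the same kind. -/
theorem exists_functionals_add_ray {E : Type*} [NormedAddCommGroup E] [NormedSpace ℝ E]
    {ι : Type} [Fintype ι] (f : ι → E →L[ℝ] ℝ) (w : E) :
    ∃ (κ : Type) (_ : Fintype κ) (g : κ → E →L[ℝ] ℝ),
      ∀ x, (∀ j, 0 ≤ g j x) ↔ ∃ t : ℝ, 0 ≤ t ∧ ∀ i, 0 ≤ f i (x - t • w) := by
  classical
  let g : {i // 0 ≤ f i w} ⊕ ({i // 0 < f i w} × {j // f j w < 0}) → E →L[ℝ] ℝ :=
    Sum.elim (fun i => f i) fun p => (f p.1 w) • f p.2 - (f p.2 w) • f p.1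
  refine ⟨_, inferInstance, g, fun x => ⟨fun h => ?_, ?_⟩⟩
  · have h1 : ∀ i, 0 ≤ f i w → 0 ≤ f i x := fun i hi => h (Sum.inl ⟨i, hi⟩)
    have h2 : ∀ i j, 0 < f i w → f j w < 0 → 0 ≤ f i w * f j x - f j w * f i x :=
      fun i j hi hj => h (Sum.inr (⟨i, hi⟩, ⟨j, hj⟩))
    -- The largest of the lower bounds for `t`.
    let L : Option {j // f j w < 0} → ℝ := fun o => o.elim 0 fun j => f j x / f j w
    obtain ⟨j₀, hj₀⟩ := Finite.exists_max L
    refine ⟨L j₀, hj₀ none, fun i => ?_⟩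
    rw [map_sub, map_smul, smul_eq_mul]
    rcases lt_trichotomy (f i w) 0 with hi | hi | hi
    · have := hj₀ (some ⟨i, hi⟩)
      change f i x / f i w ≤ L j₀ at this
      rw [div_le_iff_of_neg hi] at this
      linarith
    · rw [hi, mul_zero, sub_zero]
      exact h1 i hi.ge
    · suffices L j₀ ≤ f i x / f i w by
        rw [le_div_iff₀ hi] at this
        linarith
      cases j₀ with
      | none => exact div_nonneg (h1 i hi.le) hi.le
      | some j =>
        change f j x / f j w ≤ f i x / f i w
        have := h2 i j hi j.2
        rw [div_le_iff_of_neg j.2, div_mul_eq_mul_div, div_le_iff₀ hi]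
        linarith
  · rintro ⟨t, ht, h⟩ (i | ⟨i, j⟩)
    · have h1 := h i
      rw [map_sub, map_smul, smul_eq_mul] at h1
      change 0 ≤ f i x
      have := mul_nonneg ht i.2
      linarith
    · have h1 := h i
      have h2 := h j
      rw [map_sub, map_smul, smul_eq_mul] at h1 h2
      change 0 ≤ f i w * f j x - f j w * f i x
      have h3 := mul_nonneg i.2.le h2
      have h4 := mul_nonneg (neg_nonneg.2 j.2.le) h1
      nlinarith

theorem exists_functionals_add_cone {E α : Type*} [NormedAddCommGroup E] [NormedSpace ℝ E]
    {ι : Type} [Fintype ι] (f : ι → E →L[ℝ] ℝ) (w : α → E) (s : Finset α) :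
    ∃ (κ : Type) (_ : Fintype κ) (g : κ → E →L[ℝ] ℝ), ∀ x, (∀ j, 0 ≤ g j x) ↔
      ∃ t : α → ℝ, (∀ a ∈ s, 0 ≤ t a) ∧ ∀ i, 0 ≤ f i (x - ∑ a ∈ s, t a • w a) := by
  classical
  induction s using Finset.induction_on with
  | empty => exact ⟨ι, inferInstance, f, fun x => by simp⟩
  | insert b s hb ih =>
    obtain ⟨κ, _, g, hg⟩ := ih
    obtain ⟨κ', hκ', g', hg'⟩ := exists_functionals_add_ray g (w b)
    refine ⟨κ', hκ', g', fun x => (hg' x).trans ⟨?_, ?_⟩⟩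
    · rintro ⟨t, ht, h⟩
      obtain ⟨t', ht', h'⟩ := (hg _).1 h
      have hs : ∑ a ∈ s, (Function.update t' b t) a • w a = ∑ a ∈ s, t' a • w a :=
        Finset.sum_congr rfl fun a ha => by
          rw [Function.update_of_ne (ne_of_mem_of_not_mem ha hb)]
      refine ⟨Function.update t' b t, fun a ha => ?_, fun i => ?_⟩
      · rcases Finset.mem_insert.1 ha with rfl | ha
        · simpa using ht
        · rw [Function.update_of_ne (ne_of_mem_of_not_mem ha hb)]
          exact ht' a ha
      · rw [Finset.sum_insert hb, hs, Function.update_self, ← sub_sub]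
        exact h' i
    · rintro ⟨t, ht, h⟩
      refine ⟨t b, ht b (Finset.mem_insert_self _ _), (hg _).2
        ⟨t, fun a ha => ht a (Finset.mem_insert_of_mem ha), fun i => ?_⟩⟩
      have := h i
      rwa [Finset.sum_insert hb, ← sub_sub] at this

variable {X : Type*} [NormedAddCommGroup X] [NormedSpace ℝ X]

/-- The sum of a polytope and a cone defined by finitely many inequalities is polyhedral. The
coefficients of the convex combination are eliminated in the homogenization `X × ℝ`. -/
theorem isPolyhedral_convexHull_add {ι : Type} [Fintype ι] (f : ι → X →L[ℝ] ℝ) {F : Finset X}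
    (hF : F.Nonempty) :
    IsPolyhedral {x | ∃ c ∈ convexHull ℝ (F : Set X), ∃ v, (∀ i, 0 ≤ f i v) ∧ x = c + v} := by
  let f' : ι ⊕ Bool → (X × ℝ) →L[ℝ] ℝ :=
    Sum.elim (fun i => (f i).comp (ContinuousLinearMap.fst ℝ X ℝ))
      fun b => bif b then ContinuousLinearMap.snd ℝ X ℝ else -ContinuousLinearMap.snd ℝ X ℝ
  have hf' : ∀ p : X × ℝ, (∀ i, 0 ≤ f' i p) ↔ (∀ i, 0 ≤ f i p.1) ∧ p.2 = 0 := by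
    intro p
    rw [Sum.forall]
    refine and_congr Iff.rfl ⟨fun h => ?_, fun h b => ?_⟩
    · have h1 := h true
      have h2 := h false
      simp only [f', Sum.elim_inr, cond_true, cond_false, ContinuousLinearMap.coe_snd',
        neg_apply] at h1 h2
      linarith
    · cases b <;> simp [f', h]
  obtain ⟨κ, _, g, hg⟩ := exists_functionals_add_cone f' (fun c : X => (c, (1 : ℝ))) F
  have key : {x | ∃ c ∈ convexHull ℝ (F : Set X), ∃ v, (∀ i, 0 ≤ f i v) ∧ x = c + v} =
      {x | ∀ j, -g j (0, 1) ≤ (g j).comp (ContinuousLinearMap.inl ℝ X ℝ) x} := by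
    ext x
    have e : (∀ j, -g j (0, 1) ≤ (g j).comp (ContinuousLinearMap.inl ℝ X ℝ) x) ↔
        ∀ j, 0 ≤ g j (x, 1) := by
      refine forall_congr' fun j => ?_
      have : g j (x, 1) = g j (x, 0) + g j (0, 1) := by rw [← map_add]; simp
      rw [this]
      simp only [ContinuousLinearMap.comp_apply, ContinuousLinearMap.inl_apply]
      constructor <;> intro h <;> linarith
    rw [mem_ofPred_eq, mem_ofPred_eq, e, hg]
    simp only [hf', Prod.fst_sub, Prod.snd_sub, Prod.fst_sum, Prod.snd_sum, Prod.smul_mk,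
      smul_eq_mul, mul_one, Finset.mem_convexHull']
    constructor
    · rintro ⟨c, ⟨t, ht, h1, hc⟩, v, hv, rfl⟩
      refine ⟨t, ht, fun i => ?_, by rw [h1, sub_self]⟩
      rw [hc, add_sub_cancel_left]
      exact hv i
    · rintro ⟨t, ht, h⟩
      exact ⟨_, ⟨t, ht, by linarith [(h.2 : (1 : ℝ) - _ = 0)], rfl⟩, _, h.1,
        (add_sub_cancel _ _).symm⟩
  rw [key]
  refine isPolyhedral_of_nonempty _ _ ?_
  rw [← key]
  obtain ⟨c, hc⟩ := hF
  exact ⟨c, c, subset_convexHull _ _ hc, 0, by simp, by simp⟩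

end FourierMotzkin

section PolyhedralComponent

variable {X : Type*} [NormedAddCommGroup X] [NormedSpace ℝ X]

/-! ### Components containing a polyhedral set -/

theorem convex_setOf_exists_norm_sub_le {A : Set X} (hA : Convex ℝ A) (r : ℝ) :
    Convex ℝ {x | ∃ a ∈ A, ‖x - a‖ ≤ r} := by
  rintro x ⟨a, ha, hxa⟩ y ⟨b, hb, hyb⟩ s t hs ht hst
  refine ⟨s • a + t • b, hA ha hb hs ht hst, ?_⟩
  calc ‖s • x + t • y - (s • a + t • b)‖ = ‖s • (x - a) + t • (y - b)‖ := by congr 1; module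
    _ ≤ s * ‖x - a‖ + t * ‖y - b‖ := by
        refine (norm_add_le _ _).trans ?_
        rw [norm_smul, norm_smul, Real.norm_of_nonneg hs, Real.norm_of_nonneg ht]
    _ ≤ s * r + t * r := by gcongr
    _ = r := by rw [← add_mul, hst, one_mul]

/-- The closure of a non-empty convex set, as a point of the space of closed convex sets. -/
def closureConvH (S : Set X) (hne : S.Nonempty) (hS : Convex ℝ S) : ConvH X :=
  ⟨⟨closure S, isClosed_closure⟩, hne.closure, hS.closure⟩

theorem coe_closureConvH (S : Set X) (hne : S.Nonempty) (hS : Convex ℝ S) :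
    ((closureConvH S hne hS).1 : Set X) = closure S := rfl

theorem edist_closureConvH (A : ConvH X) (S : Set X) (hne : S.Nonempty) (hS : Convex ℝ S) :
    edist A (closureConvH S hne hS) = Metric.hausdorffEDist (A.1 : Set X) S := by
  change Metric.hausdorffEDist (A.1 : Set X) (closure S) = _
  exact Metric.hausdorffEDist_closure_right

theorem closureConvH_mem_hausdorffComponent_iff {C S : Set X} (hne : S.Nonempty)
    (hS : Convex ℝ S) :
    closureConvH S hne hS ∈ hausdorffComponent C ↔ Metric.hausdorffEDist S C < ⊤ := by
  rw [mem_hausdorffComponent_iff, coe_closureConvH, Metric.hausdorffEDist_closure_left]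

theorem hausdorffEDist_polyhedral_cone_lt_top {ι : Type*} [Fintype ι] (f : ι → X →L[ℝ] ℝ)
    (a : ι → ℝ) (hne : {x | ∀ i, a i ≤ f i x}.Nonempty) :
    Metric.hausdorffEDist {x | ∀ i, a i ≤ f i x} {v | ∀ i, 0 ≤ f i v} < ⊤ := by
  obtain ⟨b, hb⟩ := (Set.finite_range a).bddBelow
  obtain ⟨R, hR⟩ := exists_hoffman_bound f b
  refine hausdorffEDist_lt_top_of_subset_characteristicCone hne (R := R) (fun v hv x hx t ht i => ?_)
    fun x hx => hR x fun i => (hb ⟨i, rfl⟩).trans (hx i)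
  rw [map_add, map_smul, smul_eq_mul]
  have := hx i
  have := mul_nonneg ht (hv i)
  linarith

theorem isClosed_setOf_forall_nonneg {ι : Type*} (f : ι → X →L[ℝ] ℝ) :
    IsClosed {v | ∀ i, 0 ≤ f i v} := by
  simp only [ofPred_forall]
  exact isClosed_iInter fun i => isClosed_le continuous_const (f i).continuous

theorem convex_setOf_forall_nonneg {ι : Type*} (f : ι → X →L[ℝ] ℝ) :
    Convex ℝ {v | ∀ i, 0 ≤ f i v} := by
  simp only [ofPred_forall]
  exact convex_iInter fun i => convex_halfSpace_ge (f i).isLinear _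

theorem isPolyhedral_setOf_forall_nonneg {ι : Type*} [Finite ι] (f : ι → X →L[ℝ] ℝ) :
    IsPolyhedral {v | ∀ i, 0 ≤ f i v} :=
  isPolyhedral_of_nonempty f 0 ⟨0, fun i => by simp⟩

/-- A closed convex set at a finite distance from a polyhedral set has a polyhedral characteristic
cone and stays at a finite distance from it. -/
theorem characteristicCone_eq_of_polyhedral_near {C P : Set X} (hne : C.Nonempty)
    (hcl : IsClosed C) (hconv : Convex ℝ C) (hP : IsPolyhedral P)
    (hPC : Metric.hausdorffEDist P C < ⊤) :
    ∃ (n : ℕ) (f : Fin n → X →L[ℝ] ℝ), characteristicCone C = {v | ∀ i, 0 ≤ f i v} ∧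
      Metric.hausdorffEDist C {v | ∀ i, 0 ≤ f i v} < ⊤ := by
  obtain ⟨n, f, a, rfl⟩ := hP.exists_eq
  rw [Metric.hausdorffEDist_comm] at hPC
  have hPne := Metric.nonempty_of_hausdorffEDist_ne_top hne hPC.ne
  have h : Metric.hausdorffEDist C {v | ∀ i, 0 ≤ f i v} < ⊤ :=
    Metric.hausdorffEDist_triangle.trans_lt
      (ENNReal.add_lt_top.2 ⟨hPC, hausdorffEDist_polyhedral_cone_lt_top f a hPne⟩)
  refine ⟨n, f, ?_, h⟩
  obtain ⟨R, -, h₁, h₂⟩ := exists_radius_of_hausdorffEDist_lt_top h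
  refine characteristicCone_eq_of_near hcl hconv hne (isClosed_setOf_forall_nonneg f)
    (convex_setOf_forall_nonneg f) (fun v hv t ht i => ?_) h₁ h₂
  rw [map_smul]
  exact mul_nonneg ht (hv i)

/-- Closed convex sets at a finite distance from a polyhedral cone are, up to a small error, sums
of the cone and a finite set. -/
theorem exists_finite_dominating_of_near {n : ℕ} (f : Fin n → X →L[ℝ] ℝ) {A : Set X}
    (hne : A.Nonempty) (hcl : IsClosed A) (hconv : Convex ℝ A)
    (h : Metric.hausdorffEDist A {v | ∀ i, 0 ≤ f i v} < ⊤) {ε : ℝ} (hε : 0 < ε) :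
    characteristicCone A = {v | ∀ i, 0 ≤ f i v} ∧
    ∃ F : Finset X, F.Nonempty ∧ ↑F ⊆ A ∧
      ∀ x ∈ A, ∃ c ∈ F, ∃ v, (∀ i, 0 ≤ f i v) ∧ ‖x - c - v‖ ≤ ε := by
  obtain ⟨R, hR0, h₁, h₂⟩ := exists_radius_of_hausdorffEDist_lt_top h
  refine ⟨characteristicCone_eq_of_near hcl hconv hne (isClosed_setOf_forall_nonneg f)
    (convex_setOf_forall_nonneg f) (fun v hv t ht i => ?_) h₁ h₂, ?_⟩
  · rw [map_smul]
    exact mul_nonneg ht (hv i)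
  · have hbd : ∀ x ∈ A, ∀ i, -((∑ i, ‖f i‖) * R) ≤ f i x := by
      intro x hx i
      obtain ⟨v, hv, hxv⟩ := h₁ x hx
      have h1 : |f i (x - v)| ≤ (∑ i, ‖f i‖) * R := by
        refine ((f i).le_opNorm _).trans ?_
        gcongr
        exact Finset.single_le_sum (f := fun i => ‖f i‖) (fun i _ => norm_nonneg _)
          (Finset.mem_univ i)
      rw [map_sub] at h1
      have := (abs_le.1 h1).1
      have := hv i
      linarith
    obtain ⟨F, hFA, hF⟩ := exists_finite_dominating f hbd hε
    refine ⟨F, ?_, hFA, hF⟩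
    obtain ⟨x, hx⟩ := hne
    obtain ⟨c, hc, -⟩ := hF x hx
    exact ⟨c, hc⟩

theorem isApproxPolyhedral_of_near {n : ℕ} (f : Fin n → X →L[ℝ] ℝ) {C : Set X}
    (hne : C.Nonempty) (hcl : IsClosed C) (hconv : Convex ℝ C)
    (h : Metric.hausdorffEDist C {v | ∀ i, 0 ≤ f i v} < ⊤) : IsApproxPolyhedral C := by
  intro ε hε
  obtain ⟨hV, F, hFne, hFC, hF⟩ := exists_finite_dominating_of_near f hne hcl hconv h (half_pos hε)
  refine ⟨_, isPolyhedral_convexHull_add f hFne, lt_of_le_of_lt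
    (hausdorffEDist_le_ofReal (R := ε / 2) (fun x hx => ?_) ?_)
    (ENNReal.ofReal_lt_ofReal_iff_of_nonneg (by positivity) |>.2 (half_lt_self hε))⟩
  · obtain ⟨c, hc, v, hv, hx⟩ := hF x hx
    exact ⟨c + v, ⟨c, subset_convexHull _ _ hc, v, hv, rfl⟩, by rwa [← sub_sub]⟩
  · rintro _ ⟨c, hc, v, hv, rfl⟩
    refine ⟨c + v, add_mem_of_mem_characteristicCone (convexHull_min hFC hconv hc) ?_, ?_⟩
    · rw [hV]
      exact hv
    · rw [sub_self, norm_zero]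
      positivity

/-- Modulo the common kernel of finitely many functionals the space is separable. -/
theorem exists_countable_dense_mod_ker {ι : Type*} [Fintype ι] (f : ι → X →L[ℝ] ℝ) :
    ∃ D : Set X, D.Countable ∧ ∀ x : X, ∀ ε > 0, ∃ d ∈ D, ∃ l, (∀ i, f i l = 0) ∧
      ‖x - d - l‖ ≤ ε := by
  obtain ⟨K, hK, hlift⟩ := exists_lift_bound f
  let G : X → ι → ℝ := fun x i => f i x
  obtain ⟨t, ht, htc, htd⟩ := (IsSeparable.of_separableSpace (range G)).exists_countable_dense_subset
  choose! s hs using fun (y : ι → ℝ) (hy : y ∈ t) => ht hy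
  refine ⟨s '' t, htc.image s, fun x ε hε => ?_⟩
  obtain ⟨y, hyt, hy⟩ := Metric.mem_closure_iff.1 (htd ⟨x, rfl⟩) (ε / K) (by positivity)
  obtain ⟨u, hu, hun⟩ := hlift (x - s y)
  refine ⟨s y, ⟨y, hyt, rfl⟩, x - s y - u, fun i => ?_, ?_⟩
  · rw [map_sub, hu, sub_self]
  · rw [sub_sub_cancel]
    refine hun.trans ?_
    have e : (fun i => f i (x - s y)) = G x - y := by
      nth_rewrite 2 [← hs y hyt]
      ext i
      simp [G]
    rw [e, ← dist_eq_norm, mul_comm]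
    exact ((lt_div_iff₀ hK).1 hy).le

/-- The component of a polyhedral cone `V` is separable: the sets `conv F + V`, with `F` finite in
a set that is countable and dense modulo the lineality space of `V`, are dense in it. -/
theorem separableSpace_hausdorffComponent {n : ℕ} (f : Fin n → X →L[ℝ] ℝ) {C : Set X}
    (h : Metric.hausdorffEDist C {v | ∀ i, 0 ≤ f i v} < ⊤) :
    SeparableSpace (hausdorffComponent C) := by
  obtain ⟨D, hDc, hD⟩ := exists_countable_dense_mod_ker f
  have := hDc.to_subtype
  let V : Set X := {v | ∀ i, 0 ≤ f i v}
  have hVne : V.Nonempty := ⟨0, fun i => by simp⟩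
  let K : {F : Finset D // F.Nonempty} → ConvH X := fun F =>
    closureConvH (convexHull ℝ ((fun d : D => (d : X)) '' F.1) + V)
      (((F.2.to_set.image _).convexHull).add hVne)
      ((convex_convexHull ℝ _).add (convex_setOf_forall_nonneg f))
  have hsep : IsSeparable (hausdorffComponent C) := by
    refine ⟨range K, countable_range K, fun A hA => ?_⟩
    rw [EMetric.mem_closure_iff]
    intro ε' hε'
    obtain ⟨ε, hε, hεε'⟩ : ∃ ε : ℝ, 0 < ε ∧ ENNReal.ofReal (2 * ε) < ε' := by
      obtain ⟨r, hr0, hr⟩ := ENNReal.lt_iff_exists_nnreal_btwn.1 hε'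
      refine ⟨r / 2, ?_, ?_⟩
      · have : (0 : ℝ) < r := by exact_mod_cast hr0
        positivity
      · rw [mul_div_cancel₀ _ two_ne_zero, ENNReal.ofReal_coe_nnreal]
        exact hr
    obtain ⟨hAV, F, hFne, hFA, hF⟩ := exists_finite_dominating_of_near f A.2.1
      A.1.isClosed A.2.2 (Metric.hausdorffEDist_triangle.trans_lt (ENNReal.add_lt_top.2 ⟨hA, h⟩)) hε
    choose d hdD l hl hdl using fun x : X => hD x ε hε
    classical
    let F' : Finset D := F.image fun x => (⟨d x, hdD x⟩ : D)
    refine ⟨_, ⟨⟨F', hFne.image _⟩, rfl⟩, lt_of_le_of_lt ?_ hεε'⟩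
    rw [edist_closureConvH]
    refine hausdorffEDist_le_ofReal (fun x hx => ?_) ?_
    · obtain ⟨c, hc, v, hv, hxc⟩ := hF x hx
      refine ⟨d c + (l c + v), Set.add_mem_add (subset_convexHull _ _
        ⟨⟨d c, hdD c⟩, Finset.mem_coe.2 (Finset.mem_image_of_mem _ hc), rfl⟩) fun i => ?_, ?_⟩
      · rw [map_add, hl, zero_add]
        exact hv i
      · calc ‖x - (d c + (l c + v))‖ = ‖(x - c - v) + (c - d c - l c)‖ := by congr 1; abel
          _ ≤ 2 * ε := by
            have := norm_add_le (x - c - v) (c - d c - l c)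
            have := hdl c
            linarith
    · rintro _ ⟨y, hy, v, hv, rfl⟩
      have hsub : convexHull ℝ ((fun d : D => (d : X)) '' F') ⊆ {x | ∃ a ∈ A.1, ‖x - a‖ ≤ ε} := by
        refine convexHull_min ?_ (convex_setOf_exists_norm_sub_le A.2.2 ε)
        rintro _ ⟨z, hz, rfl⟩
        obtain ⟨c, hc, rfl⟩ := Finset.mem_image.1 (Finset.mem_coe.1 hz)
        refine ⟨c + -l c, add_mem_of_mem_characteristicCone (hFA hc) ?_, ?_⟩
        · rw [hAV]
          intro i
          rw [map_neg, hl, neg_zero]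
        · change ‖d c - (c + -l c)‖ ≤ ε
          rw [show d c - (c + -l c) = -(c - d c - l c) by abel, norm_neg]
          exact hdl c
      obtain ⟨a, ha, hya⟩ := hsub hy
      refine ⟨a + v, add_mem_of_mem_characteristicCone ha (by rw [hAV]; exact hv), ?_⟩
      simp only [add_sub_add_right_eq_sub]
      linarith
  exact hsep.separableSpace

theorem topologicalDensity_lt_continuum (Y : Type*) [TopologicalSpace Y] [SeparableSpace Y] :
    topologicalDensity Y < Cardinal.continuum := by
  obtain ⟨D, hDc, hD⟩ := exists_countable_dense Y
  refine (ciInf_le' _ (⟨D, hD⟩ : {D : Set Y // Dense D})).trans_lt ?_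
  exact (Cardinal.le_aleph0_iff_set_countable.2 hDc).trans_lt Cardinal.aleph0_lt_continuum

end PolyhedralComponent

section Parabola

variable {X : Type*} [NormedAddCommGroup X] [NormedSpace ℝ X]

/-! ### Infinitely hiding sets: parabolic directions -/

theorem isInfinitelyHiding_of_seq {C : Set X} (hne : C.Nonempty) (a : ℕ → X)
    (hdist : ∀ n : ℕ, ∀ y ∈ C, (n : ℝ) < ‖a n - y‖)
    (hseg : ∀ m n, m < n → (segment ℝ (a m) (a n) ∩ C).Nonempty) : IsInfinitelyHiding C := by
  obtain ⟨c₀, hc₀⟩ := hne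
  refine ⟨range a, fun hfin => ?_, ?_, ?_, ?_⟩
  · obtain ⟨M, hM⟩ := (hfin.image fun x => ‖x - c₀‖).bddAbove
    obtain ⟨n, hn⟩ := exists_nat_gt M
    have := hM ⟨a n, ⟨n, rfl⟩, rfl⟩
    have := hdist n c₀ hc₀
    simp only at *
    linarith
  · rintro _ ⟨n, rfl⟩ h
    have := hdist n _ h
    rw [sub_self, norm_zero] at this
    exact absurd this (not_lt.2 n.cast_nonneg)
  · rintro _ ⟨m, rfl⟩ _ ⟨n, rfl⟩ h
    rcases lt_trichotomy m n with hmn | rfl | hmn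
    · exact hseg m n hmn
    · exact absurd rfl h
    · rw [segment_symm]
      exact hseg n m hmn
  · refine ENNReal.eq_top_of_forall_nnreal_le fun r => ?_
    obtain ⟨n, hn⟩ := exists_nat_ge r
    refine le_trans ?_ (le_iSup₂ (f := fun x _ => Metric.infEDist x C) (a n) ⟨n, rfl⟩)
    rw [Metric.le_infEDist]
    intro y hy
    rw [edist_dist, dist_eq_norm, ← ENNReal.ofReal_coe_nnreal]
    refine ENNReal.ofReal_le_ofReal (le_trans ?_ (hdist n y hy).le)
    exact_mod_cast hn

/-- Along a ray in a direction outside the characteristic cone there are points arbitrarily far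
from the set, with arbitrarily large parameters. -/
theorem exists_far_point {C : Set X} (hcl : IsClosed C) (hconv : Convex ℝ C) {c u : X}
    (hc : c ∈ C) (hu : u ∉ characteristicCone C) (M N : ℝ) :
    ∃ t, N ≤ t ∧ 0 ≤ t ∧ ∀ y ∈ C, M < ‖c + t • u - y‖ := by
  by_contra! h
  refine hu (mem_characteristicCone_of_near hcl hconv (x := c) (R := max M (N * ‖u‖)) fun t ht => ?_)
  by_cases hN : N ≤ t
  · obtain ⟨y, hy, h⟩ := h t hN ht
    exact ⟨y, hy, h.trans (le_max_left _ _)⟩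
  · refine ⟨c, hc, le_trans ?_ (le_max_right _ _)⟩
    rw [add_sub_cancel_left, norm_smul, Real.norm_of_nonneg ht]
    exact mul_le_mul_of_nonneg_right (not_le.1 hN).le (norm_nonneg _)

/-- If `C` contains points over every point of the ray `c₀ + [0, ∞) w` in a direction `v` of the
characteristic cone, while no `w + K v` lies in that cone, then the section of `C` by the plane of
`v` and `w` grows like a parabola, and hides points on rays of increasing slope `K`. -/
theorem isInfinitelyHiding_of_parabolic {C : Set X} (hcl : IsClosed C) (hconv : Convex ℝ C)
    {c₀ v w : X} (hc₀ : c₀ ∈ C) (hv : v ∈ characteristicCone C)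
    (hray : ∀ t : ℝ, 0 ≤ t → ∃ T : ℝ, c₀ + t • w + T • v ∈ C)
    (hw : ∀ K : ℝ, w + K • v ∉ characteristicCone C) : IsInfinitelyHiding C := by
  choose! T hT using hray
  -- A triple `(t, K, M)` stands for the point `c₀ + t (w + K v)` at a distance over `M` from `C`.
  let a : ℝ × ℝ × ℝ → X := fun p => c₀ + p.1 • (w + p.2.1 • v)
  obtain ⟨p, hp, hr⟩ := exists_seq_of_forall_finset_exists
    (fun p : ℝ × ℝ × ℝ => 0 ≤ p.1 ∧ 0 ≤ p.2.2 ∧ ∀ y ∈ C, p.2.2 < ‖a p - y‖)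
    (fun p q => p.2.2 + 1 ≤ q.2.2 ∧ (segment ℝ (a p) (a q) ∩ C).Nonempty) (fun s hs => by
      obtain ⟨M, hM⟩ := (s.image fun p => p.2.2 + 1).exists_le
      obtain ⟨N, hN⟩ := (s.image fun p => p.1 + 1).exists_le
      obtain ⟨K, hK⟩ := (s.image fun p => max p.2.1 (T (p.1 + 1) - p.1 * p.2.1)).exists_le
      obtain ⟨t, hNt, ht, hfar⟩ := exists_far_point hcl hconv hc₀ (hw K) (max M 0) N
      refine ⟨(t, K, max M 0), ⟨ht, le_max_right _ _, hfar⟩, fun q hq => ⟨?_, ?_⟩⟩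
      · exact (hM _ (Finset.mem_image_of_mem _ hq)).trans (le_max_left _ _)
      · obtain ⟨s', k, m⟩ := q
        have h1 : s' + 1 ≤ t := (hN _ (Finset.mem_image_of_mem _ hq)).trans hNt
        have h2 := hK _ (Finset.mem_image_of_mem _ hq)
        have h3 : k ≤ K := (le_max_left _ _).trans h2
        have h4 : T (s' + 1) - s' * k ≤ K := (le_max_right _ _).trans h2
        have hs' : 0 ≤ s' := (hs _ hq).1
        have hts : 0 < t - s' := by linarith
        -- The point of the segment over the parameter `s' + 1`.
        refine ⟨c₀ + (s' + 1) • w + (s' * k + (t * K - s' * k) / (t - s')) • v,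
          ⟨1 - 1 / (t - s'), 1 / (t - s'), ?_, by positivity, by ring, ?_⟩, ?_⟩
        · rw [sub_nonneg, div_le_one hts]
          linarith
        · simp only [a]
          match_scalars <;> field_simp <;> ring
        · have h5 : T (s' + 1) ≤ s' * k + (t * K - s' * k) / (t - s') := by
            have : K ≤ (t * K - s' * k) / (t - s') := by
              rw [le_div_iff₀ hts]
              have := mul_le_mul_of_nonneg_left h3 hs'
              linarith
            linarith
          have h6 := hv _ (hT (s' + 1) (by linarith)) _ (sub_nonneg.2 h5)
          rwa [add_assoc _ _ (_ • v), ← add_smul, add_sub_cancel] at h6)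
  refine isInfinitelyHiding_of_seq ⟨c₀, hc₀⟩ (fun n => a (p n)) (fun n y hy => ?_)
    fun m n hmn => (hr m n hmn).2
  have hM : ∀ n : ℕ, (n : ℝ) ≤ (p n).2.2 := by
    intro n
    induction n with
    | zero => simpa using (hp 0).2.1
    | succ n ih =>
      push_cast
      linarith [(hr n (n + 1) n.lt_succ_self).1]
  exact (hM n).trans_lt ((hp n).2.2 y hy)

theorem exists_relative_interior_point [FiniteDimensional ℝ X] {C : Set X} (hne : C.Nonempty)
    (hconv : Convex ℝ C) :
    ∃ c ∈ C, ∃ ρ > 0, ∀ e ∈ vectorSpan ℝ C, ‖e‖ < ρ → c + e ∈ C := by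
  obtain ⟨c, hc⟩ := Set.Nonempty.intrinsicInterior hconv hne
  obtain ⟨y, hy, rfl⟩ := mem_intrinsicInterior.1 hc
  obtain ⟨ρ, hρ, hball⟩ := Metric.mem_nhds_iff.1 (mem_interior_iff_mem_nhds.1 hy)
  refine ⟨y, intrinsicInterior_subset hc, ρ, hρ, fun e he hen => ?_⟩
  have hmem : (y : X) + e ∈ affineSpan ℝ C := by
    rw [add_comm]
    exact AffineSubspace.vadd_mem_of_mem_direction (by rwa [direction_affineSpan]) y.2
  have : (⟨(y : X) + e, hmem⟩ : affineSpan ℝ C) ∈ Metric.ball y ρ := by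
    rw [Metric.mem_ball, Subtype.dist_eq, dist_eq_norm]
    simpa using hen
  exact hball this

/-- In finite dimension, a closed convex set with a polyhedral characteristic cone on which one of
the functionals defining the cone is unbounded below is infinitely hiding.

The direction `v` lies in the relative interior of a face of the cone that is maximal among those
on which an unbounded functional vanishes. The directions of points where that functional tends to
`-∞`, taken modulo the common kernel of the functionals vanishing at `v`, accumulate at some `w`.
Maximality of the face makes one of these functionals negative at `w`, so that no `w + K v` lies in
the cone. -/
theorem isInfinitelyHiding_of_not_bddBelow [FiniteDimensional ℝ X] {ι : Type*} [Fintype ι]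
    (f : ι → X →L[ℝ] ℝ) {C : Set X} (hne : C.Nonempty) (hcl : IsClosed C) (hconv : Convex ℝ C)
    (hV : characteristicCone C = {v | ∀ i, 0 ≤ f i v})
    {i₀ : ι} (hi₀ : ¬ BddBelow (f i₀ '' C)) : IsInfinitelyHiding C := by
  classical
  let Z : X → Finset ι := fun v => Finset.univ.filter fun i => f i v = 0
  have hZ : ∀ v i, i ∈ Z v ↔ f i v = 0 := fun v i => by simp [Z]
  let Q : X → Prop := fun v => (∀ i, 0 ≤ f i v) ∧ ∃ i ∈ Z v, ¬ BddBelow (f i '' C)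
  obtain ⟨v, ⟨hv, i₁, hi₁v, hi₁⟩, hmin⟩ : ∃ v, Q v ∧ ∀ v', Q v' → (Z v).card ≤ (Z v').card := by
    have hex : ∃ n, ∃ v, Q v ∧ (Z v).card = n :=
      ⟨_, 0, ⟨fun i => by simp, i₀, by simp [hZ], hi₀⟩, rfl⟩
    obtain ⟨v, hv, hn⟩ := Nat.find_spec hex
    exact ⟨v, hv, fun v' hv' => hn ▸ Nat.find_min' hex ⟨v', hv', rfl⟩⟩
  have hpos : ∀ i, i ∉ Z v → 0 < f i v := fun i hi =>
    (hv i).lt_of_ne fun h => hi ((hZ v i).2 h.symm)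
  -- Large multiples of `v` dominate all the functionals that do not vanish on `v`.
  have hdom : ∀ z : X, (∀ i ∈ Z v, 0 ≤ f i z) →
      ∃ T : ℝ, 0 ≤ T ∧ (∀ i, 0 ≤ f i (z + T • v)) ∧ ∀ i ∉ Z v, 0 < f i (z + T • v) := by
    intro z hz
    obtain ⟨T, hT⟩ := (Finset.univ.image fun i => (|f i z| + 1) / f i v).exists_le
    have h1 : ∀ i ∉ Z v, 0 < f i (z + max T 0 • v) := by
      intro i hi
      have h2 : (|f i z| + 1) / f i v ≤ max T 0 :=
        (hT _ (Finset.mem_image_of_mem _ (Finset.mem_univ i))).trans (le_max_left _ _)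
      rw [div_le_iff₀ (hpos i hi)] at h2
      rw [map_add, map_smul, smul_eq_mul]
      linarith [neg_abs_le (f i z)]
    refine ⟨max T 0, le_max_right _ _, fun i => ?_, h1⟩
    by_cases hi : i ∈ Z v
    · rw [map_add, map_smul, (hZ v i).1 hi, smul_zero, add_zero]
      exact hz i hi
    · exact (h1 i hi).le
  obtain ⟨c₀, hc₀, ρ, hρ, hball⟩ := exists_relative_interior_point hne hconv
  have hvC : v ∈ characteristicCone C := by rw [hV]; exact hv
  let J := {i // i ∈ Z v}
  let G : X →L[ℝ] (J → ℝ) := ContinuousLinearMap.pi fun i : J => f i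
  obtain ⟨K, hK, hlift⟩ := exists_lift_bound (fun i : J => f i)
  -- A sequence in `C` along which the `i₁`-th functional tends to `-∞`.
  have hseq : ∀ k : ℕ, ∃ c ∈ C, f i₁ (c - c₀) < -((k : ℝ) + 1) := by
    intro k
    rw [not_bddBelow_iff] at hi₁
    obtain ⟨_, ⟨c, hc, rfl⟩, h⟩ := hi₁ (f i₁ c₀ - (k + 1))
    exact ⟨c, hc, by rw [map_sub]; linarith⟩
  choose c hcC hck using hseq
  let N : ℕ → ℝ := fun k => ‖G (c k - c₀)‖
  have hNk : ∀ k : ℕ, (k : ℝ) + 1 ≤ N k := by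
    intro k
    have h1 : ‖G (c k - c₀) ⟨i₁, hi₁v⟩‖ ≤ N k := norm_le_pi_norm _ _
    have h2 : (k : ℝ) + 1 ≤ ‖G (c k - c₀) ⟨i₁, hi₁v⟩‖ := by
      rw [Real.norm_eq_abs]
      have h3 := hck k
      have h4 : G (c k - c₀) ⟨i₁, hi₁v⟩ = f i₁ (c k - c₀) := rfl
      rw [h4]
      linarith [neg_le_abs (f i₁ (c k - c₀))]
    exact h2.trans h1
  have hN0 : ∀ k, 0 < N k := fun k => lt_of_lt_of_le (by positivity) (hNk k)
  let x : ℕ → X := fun k => (N k)⁻¹ • (c k - c₀)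
  have hGx : ∀ k, G (x k) ∈ Metric.sphere (0 : J → ℝ) 1 := by
    intro k
    rw [mem_sphere_zero_iff_norm, map_smul, norm_smul, norm_inv, Real.norm_of_nonneg (hN0 k).le]
    exact inv_mul_cancel₀ (hN0 k).ne'
  obtain ⟨y, hy1, φ, hφ, hy⟩ := (isCompact_sphere (0 : J → ℝ) 1).tendsto_subseq hGx
  obtain ⟨w, rfl⟩ : ∃ w, G w = y := by
    have hclosed : IsClosed (LinearMap.range G.toLinearMap : Set (J → ℝ)) :=
      Submodule.closed_of_finiteDimensional _
    exact hclosed.mem_of_tendsto hy (Eventually.of_forall fun k => ⟨x (φ k), rfl⟩)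
  have hw1 : f i₁ w ≤ 0 := by
    have h1 := (tendsto_pi_nhds.1 hy) ⟨i₁, hi₁v⟩
    refine le_of_tendsto' h1 fun k => ?_
    change f i₁ ((N (φ k))⁻¹ • (c (φ k) - c₀)) ≤ 0
    rw [map_smul, smul_eq_mul]
    refine mul_nonpos_of_nonneg_of_nonpos (inv_nonneg.2 (hN0 _).le) ?_
    exact (hck _).le.trans (by have : (0 : ℝ) ≤ φ k := Nat.cast_nonneg _; linarith)
  by_cases hcase : ∀ i ∈ Z v, 0 ≤ f i w
  · -- Moving from `v` towards `w` leads to a larger face.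
    exfalso
    obtain ⟨T, -, hT1, hT2⟩ := hdom w hcase
    have hfi : ∀ i ∈ Z v, f i (w + T • v) = f i w := fun i hi => by
      rw [map_add, map_smul, (hZ v i).1 hi, smul_zero, add_zero]
    have hsub : Z (w + T • v) ⊆ Z v := by
      intro i hi
      by_contra h
      exact (hT2 i h).ne' ((hZ _ i).1 hi)
    have hQ : Q (w + T • v) := by
      refine ⟨hT1, i₁, ?_, hi₁⟩
      rw [hZ, hfi i₁ hi₁v]
      exact le_antisymm hw1 (hcase i₁ hi₁v)
    have heq := Finset.eq_of_subset_of_card_le hsub (hmin _ hQ)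
    have hG0 : G w = 0 := by
      ext i
      have : (i : ι) ∈ Z (w + T • v) := by rw [heq]; exact i.2
      rw [hZ, hfi i i.2] at this
      exact this
    rw [hG0, mem_sphere_zero_iff_norm, norm_zero] at hy1
    exact zero_ne_one hy1
  · push Not at hcase
    obtain ⟨i, hiv, hi⟩ := hcase
    choose u hu hun using fun k => hlift (x (φ k) - w)
    have hu0 : Tendsto (fun k => ‖u k‖) atTop (𝓝 0) := by
      have h1 : Tendsto (fun k => K * ‖G (x (φ k)) - G w‖) atTop (𝓝 0) := by
        simpa using (tendsto_iff_norm_sub_tendsto_zero.1 hy).const_mul K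
      refine squeeze_zero (fun k => norm_nonneg _) (fun k => ?_) h1
      rw [← map_sub]
      exact hun k
    -- The points `c k` may be moved along the cone so that only the part `w + u k` remains.
    have hpt : ∀ k, ∃ T : ℝ, c₀ + N (φ k) • (w + u k) + T • v ∈ C := by
      intro k
      obtain ⟨T, -, hT, -⟩ := hdom (-(N (φ k) • (x (φ k) - w - u k))) (fun j hj => by
        rw [map_neg, map_smul, map_sub, hu k ⟨j, hj⟩, sub_self, smul_zero, neg_zero])
      refine ⟨T, ?_⟩
      have h1 := add_mem_of_mem_characteristicCone (hcC (φ k))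
        (show -(N (φ k) • (x (φ k) - w - u k)) + T • v ∈ characteristicCone C by
          rw [hV]; exact hT)
      convert h1 using 1
      have h2 : c (φ k) = c₀ + N (φ k) • x (φ k) := by
        simp only [x, smul_smul, mul_inv_cancel₀ (hN0 (φ k)).ne', one_smul, add_sub_cancel]
      rw [h2]
      module
    choose T hT using hpt
    have hvspan : v ∈ vectorSpan ℝ C := by
      have := vsub_mem_vectorSpan ℝ (add_mem_of_mem_characteristicCone hc₀ hvC) hc₀
      simpa using this
    have hwu : ∀ k, w + u k ∈ vectorSpan ℝ C := by
      intro k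
      have h1 := vsub_mem_vectorSpan ℝ (hT k) hc₀
      have h2 := Submodule.smul_mem _ (N (φ k))⁻¹
        (Submodule.sub_mem _ h1 (Submodule.smul_mem _ (T k) hvspan))
      convert h2 using 1
      rw [vsub_eq_sub, show c₀ + N (φ k) • (w + u k) + T k • v - c₀ - T k • v
        = N (φ k) • (w + u k) by abel, smul_smul, inv_mul_cancel₀ (hN0 _).ne', one_smul]
    have hwspan : w ∈ vectorSpan ℝ C := by
      refine (Submodule.closed_of_finiteDimensional (vectorSpan ℝ C)).mem_of_tendsto
        (f := fun k => w + u k) (b := atTop) ?_ (Eventually.of_forall hwu)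
      simpa using (tendsto_zero_iff_norm_tendsto_zero.2 hu0).const_add w
    have huspan : ∀ k, u k ∈ vectorSpan ℝ C := fun k => by
      simpa using Submodule.sub_mem _ (hwu k) hwspan
    refine isInfinitelyHiding_of_parabolic hcl hconv hc₀ hvC (w := w) (fun t ht => ?_)
      fun k hk => ?_
    · -- The error `t u k` is absorbed by the relative interior of `C`.
      have hev1 : ∀ᶠ k in atTop, 2 * t * ‖u k‖ < ρ := by
        have : Tendsto (fun k => 2 * t * ‖u k‖) atTop (𝓝 0) := by simpa using hu0.const_mul (2 * t)
        exact this.eventually_lt_const hρ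
      obtain ⟨k, hk1, hk2⟩ := (hev1.and (eventually_ge_atTop ⌈2 * t⌉₊)).exists
      have hNt : 2 * t ≤ N (φ k) := by
        have h1 : (k : ℝ) ≤ φ k := by exact_mod_cast hφ.id_le k
        have h2 := hNk (φ k)
        have h3 := Nat.ceil_le.1 hk2
        linarith
      set l := t / N (φ k) with hl
      have hl0 : 0 ≤ l := by have := hN0 (φ k); positivity
      have hl2 : l ≤ 1 / 2 := by
        rw [hl, div_le_iff₀ (hN0 _)]
        linarith
      have hlN : l * N (φ k) = t := div_mul_cancel₀ _ (hN0 _).ne'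
      have h1l : 0 < 1 - l := by linarith
      have he : c₀ + -((t / (1 - l)) • u k) ∈ C := by
        refine hball _ (Submodule.neg_mem _ (Submodule.smul_mem _ _ (huspan k))) ?_
        rw [norm_neg, norm_smul, Real.norm_of_nonneg (by positivity)]
        refine lt_of_le_of_lt ?_ hk1
        gcongr
        rw [div_le_iff₀ h1l]
        nlinarith
      refine ⟨l * T k, ?_⟩
      have := hconv he (hT k) h1l.le hl0 (by ring)
      convert this using 1
      have h3 : (1 - l) • ((t / (1 - l)) • u k) = t • u k := by
        rw [smul_smul, mul_div_cancel₀ _ h1l.ne']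
      rw [smul_add (1 - l), smul_neg, h3, smul_add l, smul_add l, smul_smul l (N (φ k)), hlN]
      module
    · rw [hV] at hk
      have := hk i
      rw [map_add, map_smul, (hZ v i).1 hiv, smul_zero, add_zero] at this
      linarith

end Parabola

section Slices

/-! ### Slices at extreme points -/

theorem isCompact_convexJoin {E : Type*} [AddCommGroup E] [Module ℝ E] [TopologicalSpace E]
    [IsTopologicalAddGroup E] [ContinuousSMul ℝ E] {K L : Set E} (hK : IsCompact K)
    (hL : IsCompact L) : IsCompact (convexJoin ℝ K L) := by
  have h : convexJoin ℝ K L =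
      (fun p : ℝ × E × E => (1 - p.1) • p.2.1 + p.1 • p.2.2) '' (Icc 0 1 ×ˢ K ×ˢ L) := by
    ext x
    simp only [mem_convexJoin, segment_eq_image, mem_image, mem_prod, Prod.exists]
    constructor
    · rintro ⟨a, ha, b, hb, t, ht, rfl⟩
      exact ⟨t, a, b, ⟨ht, ha, hb⟩, rfl⟩
    · rintro ⟨t, a, b, ⟨ht, ha, hb⟩, rfl⟩
      exact ⟨a, ha, b, hb, t, ht, rfl⟩
  rw [h]
  exact (isCompact_Icc.prod (hK.prod hL)).image (by fun_prop)

theorem exists_compact_convex_union {E : Type*} [AddCommGroup E] [Module ℝ E] [TopologicalSpace E]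
    [IsTopologicalAddGroup E] [ContinuousSMul ℝ E] {B K L : Set E} {e : E}
    (hB : Convex ℝ B) (he : e ∈ B.extremePoints ℝ)
    (hK : IsCompact K) (hKc : Convex ℝ K) (hKB : K ⊆ B) (heK : e ∉ K)
    (hL : IsCompact L) (hLc : Convex ℝ L) (hLB : L ⊆ B) (heL : e ∉ L) :
    ∃ M, IsCompact M ∧ Convex ℝ M ∧ M ⊆ B ∧ e ∉ M ∧ K ⊆ M ∧ L ⊆ M := by
  rcases K.eq_empty_or_nonempty with rfl | hKne
  · exact ⟨L, hL, hLc, hLB, heL, empty_subset _, Subset.rfl⟩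
  rcases L.eq_empty_or_nonempty with rfl | hLne
  · exact ⟨K, hK, hKc, hKB, heK, Subset.rfl, empty_subset _⟩
  refine ⟨convexJoin ℝ K L, isCompact_convexJoin hK hL, hKc.convexJoin hLc,
    convexJoin_subset hKB hLB hB, fun h => ?_, subset_convexJoin_left hLne,
    subset_convexJoin_right hKne⟩
  obtain ⟨a, ha, b, hb, hab⟩ := mem_convexJoin.1 h
  rcases (mem_extremePoints_iff_forall_segment.1 he).2 a (hKB ha) b (hLB hb) hab with rfl | rfl
  · exact heK ha
  · exact heL hb

/-- Choquet's lemma: the open slices of a compact convex set containing an extreme point form a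
neighbourhood base at that point. -/
theorem exists_slice_subset {E : Type*} [AddCommGroup E] [Module ℝ E] [TopologicalSpace E]
    [IsTopologicalAddGroup E] [ContinuousSMul ℝ E] [T2Space E] [LocallyConvexSpace ℝ E]
    {B U : Set E} {e : E} (hBcpt : IsCompact B) (hB : Convex ℝ B) (he : e ∈ B.extremePoints ℝ)
    (hU : IsOpen U) (heU : e ∈ U) :
    ∃ (l : E →L[ℝ] ℝ) (α : ℝ), l e < α ∧ ∀ f ∈ B, l f < α → f ∈ U := by
  have hsep : ∀ z : E, ∃ (l : E →L[ℝ] ℝ) (β : ℝ), z ∈ B \ U → l z < β ∧ β < l e := by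
    intro z
    by_cases hz : z ∈ B \ U
    · have hne : z ≠ e := fun h => hz.2 (h ▸ heU)
      obtain ⟨l, hl⟩ := geometric_hahn_banach_point_point hne
      obtain ⟨β, h1, h2⟩ := exists_between hl
      exact ⟨l, β, fun _ => ⟨h1, h2⟩⟩
    · exact ⟨0, 0, fun h => absurd h hz⟩
  choose l β hlβ using hsep
  obtain ⟨t, htB, ht⟩ := (hBcpt.diff hU).elim_nhds_subcover (fun z => {f | l z f < β z})
    fun z hz => (isOpen_lt (l z).continuous continuous_const).mem_nhds (hlβ z hz).1
  -- Collect the finitely many closed slices missing `e` in a single compact convex set.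
  have hM : ∀ s : Finset E, (∀ z ∈ s, z ∈ B \ U) → ∃ M, IsCompact M ∧ Convex ℝ M ∧ M ⊆ B ∧
      e ∉ M ∧ ∀ z ∈ s, {f ∈ B | l z f ≤ β z} ⊆ M := by
    classical
    intro s
    induction s using Finset.induction_on with
    | empty => exact fun _ => ⟨∅, isCompact_empty, convex_empty, empty_subset _, by simp, by simp⟩
    | insert z s _ ih =>
      intro hs
      obtain ⟨M, h1, h2, h3, h4, h5⟩ := ih fun y hy => hs y (Finset.mem_insert_of_mem hy)
      obtain ⟨M', h1', h2', h3', h4', h5', h6'⟩ := exists_compact_convex_union (e := e) hB he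
        (K := {f ∈ B | l z f ≤ β z})
        (hBcpt.inter_right (isClosed_le (l z).continuous continuous_const))
        (hB.inter (convex_halfSpace_le (l z).isLinear _)) (fun f hf => hf.1)
        (fun h => not_le.2 (hlβ z (hs z (Finset.mem_insert_self _ _))).2 h.2) h1 h2 h3 h4
      refine ⟨M', h1', h2', h3', h4', fun y hy => ?_⟩
      rcases Finset.mem_insert.1 hy with rfl | hy
      · exact h5'
      · exact (h5 y hy).trans h6'
  obtain ⟨M, hM1, hM2, -, hM4, hM5⟩ := hM t htB
  obtain ⟨g, α, h1, h2⟩ := geometric_hahn_banach_point_closed hM2 hM1.isClosed hM4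
  refine ⟨g, α, h1, fun f hf hlt => ?_⟩
  by_contra hfU
  obtain ⟨z, hz, hfz⟩ := mem_iUnion₂.1 (ht ⟨hf, hfU⟩)
  exact lt_asymm hlt (h2 f (hM5 z hz ⟨hf, le_of_lt hfz⟩))

/-- In a regular Hausdorff space every infinite set contains a sequence whose points have pairwise
disjoint neighbourhoods. -/
theorem exists_seq_disjoint_open {T : Type*} [TopologicalSpace T] [T3Space T] {A : Set T}
    (hA : A.Infinite) : ∃ (a : ℕ → T) (U : ℕ → Set T), (∀ n, a n ∈ A) ∧ (∀ n, IsOpen (U n)) ∧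
      (∀ n, a n ∈ U n) ∧ ∀ m n, m < n → Disjoint (U m) (U n) := by
  have := hA.to_subtype
  obtain ⟨W, hWi, hWo, hWd⟩ := exists_seq_infinite_isOpen_pairwise_disjoint A
  choose O hO hOW using fun n => isOpen_induced_iff.1 (hWo n)
  choose a haW using fun n => (hWi n).nonempty
  have haO : ∀ n, (a n : T) ∈ O n := fun n => by
    have := haW n
    rw [← hOW n] at this
    exact this
  have haO' : ∀ m n, m ≠ n → (a m : T) ∉ O n := fun m n hmn h => by
    have h1 : a m ∈ W n := by
      rw [← hOW n]
      exact h
    exact Set.disjoint_left.1 (hWd hmn) (haW m) h1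
  choose F hF hFc hFO using fun n => exists_mem_nhds_isClosed_subset ((hO n).mem_nhds (haO n))
  refine ⟨fun n => a n, fun n => interior (F n) ∩ ⋂ m ∈ Finset.range n, (F m)ᶜ, fun n => (a n).2,
    fun n => ?_, fun n => ⟨mem_interior_iff_mem_nhds.2 (hF n), ?_⟩, fun m n hmn => ?_⟩
  · exact isOpen_interior.inter (isOpen_biInter_finset fun m _ => (hFc m).isOpen_compl)
  · refine mem_iInter₂.2 fun m hm h => ?_
    exact haO' n m (Finset.mem_range.1 hm).ne' (hFO m h)
  · rw [Set.disjoint_left]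
    rintro x ⟨hx, -⟩ ⟨-, hx'⟩
    exact mem_iInter₂.1 hx' m (Finset.mem_range.2 hmn) (interior_subset hx)

end Slices

section HiddenCone

variable {X : Type*} [NormedAddCommGroup X] [NormedSpace ℝ X]

/-! ### Non-polyhedral cones hide infinite sets -/

/-- A compact convex set disjoint from a closed convex cone is separated from it by a functional
that is non-negative on the cone. -/
theorem exists_nonneg_functional {V K : Set X} (hcl : IsClosed V) (hconv : Convex ℝ V)
    (h0 : (0 : X) ∈ V) (hcone : ∀ v ∈ V, ∀ t : ℝ, 0 ≤ t → t • v ∈ V) (hK : IsCompact K)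
    (hKc : Convex ℝ K) (hdisj : Disjoint K V) :
    ∃ f : X →L[ℝ] ℝ, (∀ v ∈ V, 0 ≤ f v) ∧ ∀ x ∈ K, f x < 0 := by
  obtain ⟨f, u, s, h1, h2, h3⟩ := geometric_hahn_banach_compact_closed hKc hK hconv hcl hdisj
  have hs : s < 0 := by simpa using h3 0 h0
  refine ⟨f, fun v hv => ?_, fun x hx => (h1 x hx).trans (h2.trans hs)⟩
  by_contra! hneg
  have := h3 _ (hcone v hv (s / f v) (div_nonneg_of_nonpos hs.le hneg.le))
  rw [map_smul, smul_eq_mul, div_mul_cancel₀ _ hneg.ne] at this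
  exact lt_irrefl _ this

theorem exists_nonneg_functional_point {V : Set X} (hcl : IsClosed V) (hconv : Convex ℝ V)
    (h0 : (0 : X) ∈ V) (hcone : ∀ v ∈ V, ∀ t : ℝ, 0 ≤ t → t • v ∈ V) {x : X} (hx : x ∉ V) :
    ∃ f : X →L[ℝ] ℝ, (∀ v ∈ V, 0 ≤ f v) ∧ f x < 0 := by
  obtain ⟨f, h1, h2⟩ := exists_nonneg_functional hcl hconv h0 hcone isCompact_singleton
    (convex_singleton x) (Set.disjoint_singleton_left.2 hx)
  exact ⟨f, h1, h2 x rfl⟩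

instance : LocallyConvexSpace ℝ (WeakDual ℝ X) :=
  WeakBilin.locallyConvexSpace (B := topDualPairing ℝ X)

theorem exists_eq_eval (l : WeakDual ℝ X →L[ℝ] ℝ) : ∃ z : X, ∀ f : WeakDual ℝ X, l f = f z := by
  obtain ⟨z, hz⟩ := LinearMap.dualEmbedding_surjective (topDualPairing ℝ X) l
  exact ⟨z, fun f => (DFunLike.congr_fun hz f).symm⟩

/-- A closed convex cone with an interior point that is not an intersection of finitely many
half-spaces hides an infinite set. The base `B` of the dual cone is weak-* compact with infinitely
many extreme points, and disjoint slices of `B` at extreme points correspond to points with no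
common separating functional. -/
theorem exists_hidden_seq_of_interior {V : Set X} (hcl : IsClosed V) (hconv : Convex ℝ V)
    (h0 : (0 : X) ∈ V) (hcone : ∀ v ∈ V, ∀ t : ℝ, 0 ≤ t → t • v ∈ V) {v₀ : X} {δ : ℝ} (hδ : 0 < δ)
    (hv₀ : ∀ e, ‖e‖ ≤ δ → v₀ + e ∈ V)
    (hnot : ¬ ∃ (n : ℕ) (f : Fin n → X →L[ℝ] ℝ), V = {v | ∀ i, 0 ≤ f i v}) :
    ∃ a : ℕ → X, (∀ n, a n ∉ V) ∧ ∀ m n, m < n → (segment ℝ (a m) (a n) ∩ V).Nonempty := by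
  have hbound : ∀ f : X →L[ℝ] ℝ, (∀ v ∈ V, 0 ≤ f v) → ‖f‖ ≤ f v₀ / δ := by
    intro f hf
    have hfv₀ : 0 ≤ f v₀ := hf _ (by simpa using hv₀ 0 (by simpa using hδ.le))
    refine ContinuousLinearMap.opNorm_le_of_unit_norm (by positivity) fun e he => ?_
    have h1 := hf _ (hv₀ (δ • e) (by rw [norm_smul, he, mul_one, Real.norm_of_nonneg hδ.le]))
    have h2 := hf _ (hv₀ (-(δ • e))
      (by rw [norm_neg, norm_smul, he, mul_one, Real.norm_of_nonneg hδ.le]))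
    rw [map_add, map_neg, map_smul, smul_eq_mul] at h2
    rw [map_add, map_smul, smul_eq_mul] at h1
    rw [Real.norm_eq_abs, abs_le, le_div_iff₀ hδ, ← neg_div, div_le_iff₀ hδ]
    exact ⟨by linarith, by linarith⟩
  have hpos : ∀ f : X →L[ℝ] ℝ, (∀ v ∈ V, 0 ≤ f v) → (∃ x, f x < 0) → 0 < f v₀ := by
    rintro f hf ⟨x, hx⟩
    by_contra! h
    have h1 : ‖f‖ ≤ 0 := (hbound f hf).trans (div_nonpos_of_nonpos_of_nonneg h hδ.le)
    rw [norm_le_zero_iff.1 h1] at hx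
    simp at hx
  let B : Set (WeakDual ℝ X) := {f | (∀ v ∈ V, 0 ≤ f v) ∧ f v₀ = 1}
  have hmemB : ∀ f : X →L[ℝ] ℝ, (∀ v ∈ V, 0 ≤ f v) → 0 < f v₀ →
      StrongDual.toWeakDual ((f v₀)⁻¹ • f) ∈ B := by
    intro f hf hf0
    refine ⟨fun v hv => ?_, ?_⟩
    · exact mul_nonneg (inv_nonneg.2 hf0.le) (hf v hv)
    · exact inv_mul_cancel₀ hf0.ne'
  have hBcl : IsClosed B := by
    have : B = (⋂ v ∈ V, {f : WeakDual ℝ X | 0 ≤ f v}) ∩ {f | f v₀ = 1} := by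
      ext f
      simp [B]
    rw [this]
    exact (isClosed_biInter fun v _ => isClosed_le continuous_const
      (WeakDual.eval_continuous v)).inter
      (isClosed_eq (WeakDual.eval_continuous v₀) continuous_const)
  have hBcpt : IsCompact B := by
    refine (WeakDual.isCompact_closedBall (𝕜 := ℝ) (0 : StrongDual ℝ X) δ⁻¹).of_isClosed_subset
      hBcl fun f hf => ?_
    rw [mem_preimage, mem_closedBall_zero_iff]
    have := hbound (WeakDual.toStrongDual f) hf.1
    rwa [WeakDual.toStrongDual_apply, hf.2, one_div] at this
  have hBconv : Convex ℝ B := by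
    rintro f ⟨hf1, hf2⟩ g ⟨hg1, hg2⟩ s t hs ht hst
    refine ⟨fun v hv => ?_, ?_⟩
    · change 0 ≤ s * f v + t * g v
      exact add_nonneg (mul_nonneg hs (hf1 v hv)) (mul_nonneg ht (hg1 v hv))
    · change s * f v₀ + t * g v₀ = 1
      rw [hf2, hg2, mul_one, mul_one, hst]
  have hVB : ∀ x, (∀ f ∈ B, 0 ≤ f x) → x ∈ V := by
    intro x hx
    by_contra hxV
    obtain ⟨f, h1, h2⟩ := exists_nonneg_functional_point hcl hconv h0 hcone hxV
    have h3 := hpos f h1 ⟨x, h2⟩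
    have h4 : 0 ≤ (f v₀)⁻¹ * f x := hx _ (hmemB f h1 h3)
    exact absurd h4 (not_le.2 (mul_neg_of_pos_of_neg (inv_pos.2 h3) h2))
  have hinf : (B.extremePoints ℝ).Infinite := by
    intro hfin
    have := hfin.to_subtype
    obtain ⟨n, ⟨e⟩⟩ := Finite.exists_equiv_fin (B.extremePoints ℝ)
    refine hnot ⟨n, fun i => WeakDual.toStrongDual (e.symm i : WeakDual ℝ X), ?_⟩
    ext x
    refine ⟨fun hx i => (extremePoints_subset (e.symm i).2).1 x hx, fun hx => hVB x fun f hf => ?_⟩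
    rw [← closure_convexHull_extremePoints hBcpt hBconv] at hf
    refine closure_minimal (convexHull_min ?_ ?_)
      (isClosed_le continuous_const (WeakDual.eval_continuous x)) hf
    · intro g hg
      have h1 : 0 ≤ (e.symm (e ⟨g, hg⟩) : WeakDual ℝ X) x := hx (e ⟨g, hg⟩)
      rwa [e.symm_apply_apply] at h1
    · intro g hg k hk s t hs ht _
      change 0 ≤ s * g x + t * k x
      exact add_nonneg (mul_nonneg hs hg) (mul_nonneg ht hk)
  obtain ⟨e, U, heB, hUo, heU, hUd⟩ := exists_seq_disjoint_open hinf
  have hslice : ∀ n, ∃ a : X, e n a < 0 ∧ ∀ f ∈ B, f a < 0 → f ∈ U n := by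
    intro n
    obtain ⟨l, α, h1, h2⟩ := exists_slice_subset hBcpt hBconv (heB n) (hUo n) (heU n)
    obtain ⟨z, hz⟩ := exists_eq_eval l
    have key : ∀ f ∈ B, f (z - α • v₀) = l f - α := fun f hf => by
      rw [map_sub, map_smul, hf.2, hz, smul_eq_mul, mul_one]
    refine ⟨z - α • v₀, ?_, fun f hf h => h2 f hf ?_⟩
    · rw [key _ (extremePoints_subset (heB n))]
      linarith
    · rw [key f hf] at h
      linarith
  choose a ha1 ha2 using hslice
  refine ⟨a, fun n h => not_le.2 (ha1 n) ((extremePoints_subset (heB n)).1 _ h), fun m n hmn => ?_⟩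
  by_contra hempty
  have hdisj : Disjoint (segment ℝ (a m) (a n)) V := by
    rw [Set.disjoint_iff_inter_eq_empty]
    exact Set.not_nonempty_iff_eq_empty.1 hempty
  have hcpt : IsCompact (segment ℝ (a m) (a n)) := by
    rw [segment_eq_image]
    exact isCompact_Icc.image (by fun_prop)
  obtain ⟨f, h1, h2⟩ := exists_nonneg_functional hcl hconv h0 hcone hcpt (convex_segment _ _) hdisj
  have h3 := hpos f h1 ⟨_, h2 _ (left_mem_segment ℝ _ _)⟩
  have h4 : ∀ k, f (a k) < 0 → StrongDual.toWeakDual ((f v₀)⁻¹ • f) ∈ U k := fun k hk =>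
    ha2 k _ (hmemB f h1 h3) (mul_neg_of_pos_of_neg (inv_pos.2 h3) hk)
  exact Set.disjoint_left.1 (hUd m n hmn) (h4 m (h2 _ (left_mem_segment ℝ _ _)))
    (h4 n (h2 _ (right_mem_segment ℝ _ _)))

/-- Points hidden by the characteristic cone, moved far away, are hidden by the set itself. -/
theorem isInfinitelyHiding_of_characteristicCone {C : Set X} (hne : C.Nonempty) (hcl : IsClosed C)
    (hconv : Convex ℝ C) (a : ℕ → X) (ha : ∀ n, a n ∉ characteristicCone C)
    (hseg : ∀ m n, m < n → (segment ℝ (a m) (a n) ∩ characteristicCone C).Nonempty) :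
    IsInfinitelyHiding C := by
  obtain ⟨c₀, hc₀⟩ := hne
  choose t ht1 _ ht using fun n : ℕ => exists_far_point hcl hconv hc₀ (ha n) n 1
  refine isInfinitelyHiding_of_seq ⟨c₀, hc₀⟩ (fun n => c₀ + t n • a n) (fun n => ht n)
    fun m n hmn => ?_
  obtain ⟨_, ⟨p, q, hp, hq, hpq, rfl⟩, hx⟩ := hseg m n hmn
  have hm : 0 < t m := by linarith [ht1 m]
  have hn : 0 < t n := by linarith [ht1 n]
  -- The weights `p / t m` and `q / t n`, normalized.
  set s := p / t m + q / t n with hs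
  have hs0 : 0 < s := by
    rcases hp.eq_or_lt with rfl | hp
    · have : q = 1 := by linarith
      rw [hs, this]
      positivity
    · positivity
  refine ⟨c₀ + s⁻¹ • (p • a m + q • a n), ⟨s⁻¹ * (p / t m), s⁻¹ * (q / t n), by positivity,
    by positivity, ?_, ?_⟩, hx _ hc₀ _ (by positivity)⟩
  · rw [← mul_add, ← hs, inv_mul_cancel₀ hs0.ne']
  · have h1 : s⁻¹ * (p / t m) + s⁻¹ * (q / t n) = 1 := by
      rw [← mul_add, ← hs, inv_mul_cancel₀ hs0.ne']
    have e1 : s⁻¹ * (p / t m) * t m = s⁻¹ * p := by field_simp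
    have e2 : s⁻¹ * (q / t n) * t n = s⁻¹ * q := by field_simp
    calc (s⁻¹ * (p / t m)) • (c₀ + t m • a m) + (s⁻¹ * (q / t n)) • (c₀ + t n • a n)
        = (s⁻¹ * (p / t m) + s⁻¹ * (q / t n)) • c₀ + (s⁻¹ * (p / t m) * t m) • a m
          + (s⁻¹ * (q / t n) * t n) • a n := by module
      _ = c₀ + s⁻¹ • (p • a m + q • a n) := by rw [h1, e1, e2]; module

end HiddenCone

section CompactDual

variable {X : Type*} [NormedAddCommGroup X] [NormedSpace ℝ X]

/-! ### Cones whose dual cone has a compact unit sphere -/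

theorem isInfinitelyHiding_of_polyhedral_of_not_bddBelow {n : ℕ} (f : Fin n → X →L[ℝ] ℝ)
    {C : Set X} (hne : C.Nonempty) (hcl : IsClosed C) (hconv : Convex ℝ C)
    (hV : characteristicCone C = {v | ∀ i, 0 ≤ f i v}) {i₀ : Fin n}
    (hi₀ : ¬ BddBelow (f i₀ '' C)) : IsInfinitelyHiding C := by
  -- Everything factors through the finite-dimensional range of `x ↦ (f i x)ᵢ`.
  let G₀ : X →L[ℝ] (Fin n → ℝ) := ContinuousLinearMap.pi f
  let R : Submodule ℝ (Fin n → ℝ) := LinearMap.range (G₀ : X →ₗ[ℝ] (Fin n → ℝ))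
  let G : X →L[ℝ] R := G₀.codRestrict R fun x => ⟨x, rfl⟩
  have hGf : ∀ x i, (G x : Fin n → ℝ) i = f i x := fun x i => rfl
  have hsurj : LinearMap.range (G : X →ₗ[ℝ] R) = ⊤ := by
    rw [LinearMap.range_eq_top]
    rintro ⟨_, x, rfl⟩
    exact ⟨x, rfl⟩
  obtain ⟨S₀, hS₀⟩ := LinearMap.exists_rightInverse_of_surjective _ hsurj
  let S : R →L[ℝ] X := LinearMap.toContinuousLinearMap S₀
  have hGS : ∀ r, G (S r) = r := fun r => LinearMap.congr_fun hS₀ r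
  have hfS : ∀ r i, f i (S r) = (r : Fin n → ℝ) i := fun r i => by rw [← hGf, hGS]
  have hC : ∀ c ∈ C, S (G c) ∈ C := by
    intro c hc
    have hv : S (G c) - c ∈ characteristicCone C := by
      rw [hV]
      intro i
      rw [map_sub, hfS, hGf, sub_self]
    simpa using add_mem_of_mem_characteristicCone hc hv
  have hC' : ∀ c, S (G c) ∈ C → c ∈ C := by
    intro c hc
    have hv : c - S (G c) ∈ characteristicCone C := by
      rw [hV]
      intro i
      rw [map_sub, hfS, hGf, sub_self]
    simpa using add_mem_of_mem_characteristicCone hc hv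
  let f' : Fin n → R →L[ℝ] ℝ := fun i => (ContinuousLinearMap.proj i).comp R.subtypeL
  have hV' : characteristicCone (S ⁻¹' C) = {r | ∀ i, 0 ≤ f' i r} := by
    have h : ∀ r, r ∈ characteristicCone (S ⁻¹' C) ↔ S r ∈ characteristicCone C := by
      intro r
      constructor
      · intro hr c hc t ht
        refine hC' _ ?_
        have := hr (G c) (hC c hc) t ht
        rwa [map_add, map_smul, hGS]
      · intro hr c hc t ht
        rw [mem_preimage, map_add, map_smul]
        exact hr _ hc t ht
    ext r
    rw [h, hV]
    exact forall_congr' fun i => by rw [hfS]; rfl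
  obtain ⟨A, hAinf, hAC, hAh, hAd⟩ := isInfinitelyHiding_of_not_bddBelow f' (C := S ⁻¹' C)
    (hne.elim fun c hc => ⟨G c, hC c hc⟩) (hcl.preimage S.continuous)
    (hconv.linear_preimage S₀) hV' (i₀ := i₀) (by
      rintro ⟨b, hb⟩
      refine hi₀ ⟨b, ?_⟩
      rintro _ ⟨c, hc, rfl⟩
      exact hb ⟨G c, hC c hc, rfl⟩)
  have hinj : Function.Injective S := fun x y hxy => by rw [← hGS x, hxy, hGS]
  refine ⟨S '' A, hAinf.image hinj.injOn, ?_, ?_, ?_⟩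
  · rintro _ ⟨a, ha, rfl⟩
    exact hAC ha
  · rintro _ ⟨a, ha, rfl⟩ _ ⟨b, hb, rfl⟩ hab
    obtain ⟨_, ⟨p, q, hp, hq, hpq, rfl⟩, hz⟩ := hAh a ha b hb fun h => hab (h ▸ rfl)
    refine ⟨_, ⟨p, q, hp, hq, hpq, rfl⟩, ?_⟩
    rwa [mem_preimage, map_add, map_smul, map_smul] at hz
  · by_contra hlt
    have hle : ∀ a ∈ A, Metric.infEDist a (S ⁻¹' C) ≤
        (‖G‖₊ + 1 : NNReal) * ⨆ x ∈ S '' A, Metric.infEDist x C := by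
      intro a ha
      refine le_trans ?_ (mul_le_mul_right (le_iSup₂_of_le (S a) ⟨a, ha, rfl⟩ le_rfl) _)
      rw [← ENNReal.div_le_iff' (by simp) ENNReal.coe_ne_top, Metric.le_infEDist]
      intro c hc
      refine ENNReal.div_le_of_le_mul' ?_
      have h1 : edist a (G c) ≤ (‖G‖₊ + 1 : NNReal) * edist (S a) c := by
        have h := (G.lipschitz.weaken (K' := ‖G‖₊ + 1) (by simp)) (S a) c
        rwa [hGS] at h
      exact (Metric.infEDist_le_edist_of_mem (s := S ⁻¹' C) (hC c hc)).trans h1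
    refine (lt_of_le_of_lt (iSup₂_le hle) (ENNReal.mul_lt_top ENNReal.coe_lt_top
      (lt_top_iff_ne_top.2 hlt))).ne hAd

/-- The unit sphere of the dual cone of `V`. -/
def dualSphere (V : Set X) : Set (X →L[ℝ] ℝ) := {f | (∀ v ∈ V, 0 ≤ f v) ∧ ‖f‖ = 1}

theorem inv_norm_smul_mem_dualSphere {V : Set X} {f : X →L[ℝ] ℝ} (hf : ∀ v ∈ V, 0 ≤ f v)
    (h0 : f ≠ 0) : ‖f‖⁻¹ • f ∈ dualSphere V := by
  refine ⟨fun v hv => mul_nonneg (by positivity) (hf v hv), ?_⟩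
  rw [norm_smul, norm_inv, norm_norm, inv_mul_cancel₀ (norm_ne_zero_iff.2 h0)]

/-- If the dual sphere of a cone with dense span is compact, then the cone has an interior point:
finitely many points of the cone suffice to make their sum bounded away from zero on the sphere. -/
theorem exists_interior_of_isCompact_dualSphere {V : Set X} (hcl : IsClosed V) (hconv : Convex ℝ V)
    (h0 : (0 : X) ∈ V) (hcone : ∀ v ∈ V, ∀ t : ℝ, 0 ≤ t → t • v ∈ V)
    (hspan : ∀ f : X →L[ℝ] ℝ, (∀ v ∈ V, f v = 0) → f = 0) (hK : IsCompact (dualSphere V)) :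
    ∃ (v₀ : X) (δ : ℝ), 0 < δ ∧ ∀ e, ‖e‖ ≤ δ → v₀ + e ∈ V := by
  have hev : ∀ v : X, Continuous fun f : X →L[ℝ] ℝ => f v := fun v => by fun_prop
  have hpos : ∀ f ∈ dualSphere V, ∃ v ∈ V, 0 < f v := by
    rintro f ⟨hf, hf1⟩
    by_contra! h
    have : f = 0 := hspan f fun v hv => le_antisymm (h v hv) (hf v hv)
    simp [this] at hf1
  obtain ⟨b, hbV, hbfin, hb⟩ := hK.elim_finite_subcover_image (b := V)
    (c := fun v => {f : X →L[ℝ] ℝ | 0 < f v})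
    (fun v _ => isOpen_lt continuous_const (hev v)) fun f hf => by
      obtain ⟨v, hv, h⟩ := hpos f hf
      exact mem_iUnion₂.2 ⟨v, hv, h⟩
  set v₀ := ∑ v ∈ hbfin.toFinset, v with hv₀
  have hfv₀ : ∀ f ∈ dualSphere V, 0 < f v₀ := by
    intro f hf
    obtain ⟨v, hv, h⟩ := mem_iUnion₂.1 (hb hf)
    rw [hv₀, map_sum]
    exact Finset.sum_pos' (fun w hw => hf.1 w (hbV (hbfin.mem_toFinset.1 hw)))
      ⟨v, hbfin.mem_toFinset.2 hv, h⟩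
  obtain ⟨δ, hδ, hδf⟩ : ∃ δ : ℝ, 0 < δ ∧ ∀ f ∈ dualSphere V, δ ≤ f v₀ := by
    rcases (dualSphere V).eq_empty_or_nonempty with h | h
    · exact ⟨1, one_pos, by simp [h]⟩
    · obtain ⟨f, hf, hmin⟩ := hK.exists_isMinOn h (hev v₀).continuousOn
      exact ⟨f v₀, hfv₀ f hf, fun g hg => hmin hg⟩
  refine ⟨v₀, δ, hδ, fun e he => ?_⟩
  by_contra hmem
  obtain ⟨g, hg, hneg⟩ := exists_nonneg_functional_point hcl hconv h0 hcone hmem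
  have hg0 : g ≠ 0 := by
    rintro rfl
    simp at hneg
  have h1 := hδf _ (inv_norm_smul_mem_dualSphere hg hg0)
  have h2 : ‖g e‖ ≤ ‖g‖ * δ := (g.le_opNorm e).trans (by gcongr)
  have h3 : 0 < ‖g‖ := norm_pos_iff.2 hg0
  have h4 : δ ≤ ‖g‖⁻¹ * g v₀ := h1
  rw [inv_mul_eq_div, le_div_iff₀ h3] at h4
  rw [map_add] at hneg
  have := neg_le_of_abs_le h2
  linarith

theorem isCompact_image_inter_norm_eq_one {E F : Type*} [NormedAddCommGroup E] [NormedSpace ℝ E]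
    [NormedAddCommGroup F] [NormedSpace ℝ F] (T : E →L[ℝ] F) {K : Set E} (hK : IsCompact K) :
    IsCompact (T '' (K ∩ {x | ‖T x‖ = 1})) :=
  (hK.inter_right (isClosed_eq T.continuous.norm continuous_const)).image T.continuous

/-- Compactness of the dual sphere passes to a subspace containing the cone, by norm-preserving
extension of functionals. -/
theorem isCompact_dualSphere_subspace {V : Set X} (Z : Submodule ℝ X) (hVZ : V ⊆ Z)
    (hK : IsCompact (dualSphere V)) : IsCompact (dualSphere ((↑) ⁻¹' V : Set Z)) := by
  let T : (X →L[ℝ] ℝ) →L[ℝ] (Z →L[ℝ] ℝ) := (ContinuousLinearMap.compL ℝ Z X ℝ).flip Z.subtypeL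
  have hT : ∀ f z, T f z = f z := fun f z => rfl
  have : dualSphere ((↑) ⁻¹' V : Set Z) = T '' (dualSphere V ∩ {f | ‖T f‖ = 1}) := by
    ext g
    constructor
    · rintro ⟨hg, hg1⟩
      obtain ⟨f, hfg, hf1⟩ := exists_extension_norm_eq Z g
      have hcomp : T f = g := by
        ext z
        exact hfg z
      refine ⟨f, ⟨⟨fun v hv => ?_, hf1.trans hg1⟩, ?_⟩, hcomp⟩
      · rw [hfg ⟨v, hVZ hv⟩]
        exact hg ⟨v, hVZ hv⟩ hv
      · rw [mem_ofPred_eq, hcomp, hg1]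
    · rintro ⟨f, ⟨⟨hf, -⟩, hf1⟩, rfl⟩
      exact ⟨fun v hv => hf _ hv, hf1⟩
  have h := isCompact_image_inter_norm_eq_one (F := Z →L[ℝ] ℝ) T hK
  rwa [← this] at h

/-- A linear subspace with a compact unit sphere is finite-dimensional. -/
theorem exists_finite_spanning {E : Type*} [NormedAddCommGroup E] [NormedSpace ℝ E]
    (N : Submodule ℝ E) (hN : IsCompact {x | x ∈ N ∧ ‖x‖ = 1}) :
    ∃ (n : ℕ) (b : Fin n → E), (∀ j, b j ∈ N) ∧ ∀ x ∈ N, ∃ c : Fin n → ℝ, x = ∑ j, c j • b j := by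
  have hsph : IsCompact (Metric.sphere (0 : N) 1) := by
    rw [Subtype.isCompact_iff]
    convert hN
    ext f
    constructor
    · rintro ⟨g, hg, rfl⟩
      exact ⟨g.2, mem_sphere_zero_iff_norm.1 hg⟩
    · rintro ⟨h2, h1⟩
      exact ⟨⟨f, h2⟩, mem_sphere_zero_iff_norm.2 h1, rfl⟩
  have hcont : Continuous fun p : ℝ × N => p.1 • p.2 := continuous_fst.smul continuous_snd
  have hball : IsCompact (Metric.closedBall (0 : N) 1) := by
    refine ((((isCompact_Icc (a := (0 : ℝ)) (b := 1)).prod hsph).image hcont).union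
      (isCompact_singleton (x := (0 : N)))).of_isClosed_subset Metric.isClosed_closedBall
      fun f hf => ?_
    by_cases h0 : f = 0
    · exact Or.inr h0
    · refine Or.inl ⟨(‖f‖, ‖f‖⁻¹ • f), ⟨⟨norm_nonneg _, mem_closedBall_zero_iff.1 hf⟩, ?_⟩, ?_⟩
      · rw [mem_sphere_zero_iff_norm, norm_smul, norm_inv, norm_norm,
          inv_mul_cancel₀ (norm_ne_zero_iff.2 h0)]
      · exact smul_inv_smul₀ (norm_ne_zero_iff.2 h0) f
  have : FiniteDimensional ℝ N := FiniteDimensional.of_isCompact_closedBall₀ ℝ one_pos hball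
  let b := Module.finBasis ℝ N
  refine ⟨_, fun j => b j, fun j => (b j).2, fun x hx => ⟨b.repr ⟨x, hx⟩, ?_⟩⟩
  have h := congrArg N.subtype (b.sum_repr ⟨x, hx⟩)
  rw [map_sum] at h
  exact h.symm

/-- The functionals vanishing on `V` form a finite-dimensional space if the dual sphere of `V` is
compact. -/
theorem exists_finite_spanning_annihilator {V : Set X} (hK : IsCompact (dualSphere V)) :
    ∃ (n : ℕ) (b : Fin n → X →L[ℝ] ℝ), (∀ j, ∀ v ∈ V, b j v = 0) ∧
      ∀ f : X →L[ℝ] ℝ, (∀ v ∈ V, f v = 0) → ∃ c : Fin n → ℝ, ∀ x, f x = ∑ j, c j * b j x := by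
  have hcl : IsClosed {f : X →L[ℝ] ℝ | ∀ v ∈ V, f v = 0} := by
    have : {f : X →L[ℝ] ℝ | ∀ v ∈ V, f v = 0} = ⋂ v ∈ V, {f | f v = 0} := by
      ext f
      simp
    rw [this]
    exact isClosed_biInter fun v _ => isClosed_eq (by fun_prop) continuous_const
  let N : Submodule ℝ (X →L[ℝ] ℝ) :=
    { carrier := {f | ∀ v ∈ V, f v = 0}
      add_mem' := fun {f g} hf hg v hv => by
        change f v + g v = 0
        rw [hf v hv, hg v hv, add_zero]
      zero_mem' := fun v _ => rfl
      smul_mem' := fun c f hf v hv => by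
        change c * f v = 0
        rw [hf v hv, mul_zero] }
  have hN : IsCompact {f | f ∈ N ∧ ‖f‖ = 1} := by
    convert hK.inter_right hcl using 1
    ext f
    exact ⟨fun h => ⟨⟨fun v hv => (h.1 v hv).ge, h.2⟩, h.1⟩, fun h => ⟨h.2, h.1.2⟩⟩
  obtain ⟨n, b, hb, h⟩ := exists_finite_spanning N hN
  refine ⟨n, b, hb, fun f hf => ?_⟩
  obtain ⟨c, rfl⟩ := h f hf
  exact ⟨c, fun x => by simp⟩

/-- A cone that is cut out by finitely many functionals in a closed subspace is cut out by finitely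
many functionals in the whole space, if its dual sphere is compact: the subspace is then the common
kernel of finitely many functionals. -/
theorem exists_eq_setOf_forall_nonneg {V : Set X} (Z : Submodule ℝ X) (hZ : IsClosed (Z : Set X))
    (hVZ : V ⊆ Z) (hK : IsCompact (dualSphere V)) {n : ℕ} (g : Fin n → Z →L[ℝ] ℝ)
    (hg : ((↑) ⁻¹' V : Set Z) = {z | ∀ i, 0 ≤ g i z}) :
    ∃ (m : ℕ) (f : Fin m → X →L[ℝ] ℝ), V = {v | ∀ i, 0 ≤ f i v} := by
  obtain ⟨k, b, hbV, hb⟩ := exists_finite_spanning_annihilator hK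
  choose g' hg' _ using fun i => exists_extension_norm_eq Z (g i)
  have hmem : ∀ x, (∀ j, b j x = 0) → x ∈ Z := by
    intro x hx
    by_contra hxZ
    obtain ⟨f, h1, h2⟩ := exists_nonneg_functional_point hZ Z.convex Z.zero_mem
      (fun v hv t _ => Z.smul_mem t hv) hxZ
    have hf : ∀ v ∈ V, f v = 0 := fun v hv => le_antisymm
      (by simpa using h1 (-v) (Z.neg_mem (hVZ hv))) (h1 v (hVZ hv))
    obtain ⟨c, hc⟩ := hb f hf
    have := hc x
    simp only [hx, mul_zero, Finset.sum_const_zero] at this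
    exact h2.ne this
  let F : Fin n ⊕ (Fin k ⊕ Fin k) → X →L[ℝ] ℝ :=
    Sum.elim g' (Sum.elim b fun j => -b j)
  let e := Fintype.equivFin (Fin n ⊕ (Fin k ⊕ Fin k))
  refine ⟨_, fun i => F (e.symm i), ?_⟩
  have key : ∀ x, (∀ i, 0 ≤ F (e.symm i) x) ↔ ∀ i, 0 ≤ F i x := fun x =>
    e.symm.forall_congr_left.trans (by simp)
  ext x
  rw [mem_ofPred_eq, key]
  constructor
  · intro hx i
    rcases i with i | j | j
    · have h : (⟨x, hVZ hx⟩ : Z) ∈ ((↑) ⁻¹' V : Set Z) := hx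
      rw [hg] at h
      exact (h i).trans_eq (hg' i ⟨x, hVZ hx⟩).symm
    · exact (hbV j x hx).ge
    · exact (neg_eq_zero.2 (hbV j x hx)).ge
  · intro hx
    have hxZ : x ∈ Z := hmem x fun j =>
      le_antisymm (neg_nonneg.1 (hx (Sum.inr (Sum.inr j)))) (hx (Sum.inr (Sum.inl j)))
    have h : (⟨x, hxZ⟩ : Z) ∈ ((↑) ⁻¹' V : Set Z) := by
      rw [hg]
      exact fun i => (hx (Sum.inl i)).trans_eq (hg' i ⟨x, hxZ⟩)
    exact h

/-- If the dual cone of the characteristic cone has a compact unit sphere, then either the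
characteristic cone is polyhedral and close to `C`, or `C` is infinitely hiding. Inside the closed
span of the cone, compactness yields an interior point; outside of it, there is only a
finite-dimensional amount of room. -/
theorem polyhedral_or_isInfinitelyHiding {C : Set X} (hne : C.Nonempty) (hcl : IsClosed C)
    (hconv : Convex ℝ C) (hK : IsCompact (dualSphere (characteristicCone C))) :
    (IsPolyhedral (characteristicCone C) ∧
      Metric.hausdorffEDist C (characteristicCone C) < ⊤) ∨ IsInfinitelyHiding C := by
  set V := characteristicCone C with hV
  have hVcl : IsClosed V := isClosed_characteristicCone hcl
  have hVconv : Convex ℝ V := convex_characteristicCone C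
  let Z : Submodule ℝ X := (Submodule.span ℝ V).topologicalClosure
  have hVZ : V ⊆ Z := Submodule.subset_span.trans (Submodule.le_topologicalClosure _)
  have hspan : ∀ f : Z →L[ℝ] ℝ, (∀ v ∈ ((↑) ⁻¹' V : Set Z), f v = 0) → f = 0 := by
    intro f hf
    obtain ⟨F, hF, -⟩ := exists_extension_norm_eq Z f
    have hZF : Z ≤ LinearMap.ker (F : X →ₗ[ℝ] ℝ) := by
      refine Submodule.topologicalClosure_minimal _ (Submodule.span_le.2 fun v hv => ?_)
        (F.isClosed_ker)
      exact (hF ⟨v, hVZ hv⟩).trans (hf ⟨v, hVZ hv⟩ hv)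
    ext z
    rw [← hF z]
    exact hZF z.2
  have hcl' : IsClosed ((↑) ⁻¹' V : Set Z) := hVcl.preimage continuous_subtype_val
  have hconv' : Convex ℝ ((↑) ⁻¹' V : Set Z) := hVconv.linear_preimage Z.subtype
  have h0' : (0 : Z) ∈ ((↑) ⁻¹' V : Set Z) := zero_mem_characteristicCone C
  have hcone' : ∀ v ∈ ((↑) ⁻¹' V : Set Z), ∀ t : ℝ, 0 ≤ t → t • v ∈ ((↑) ⁻¹' V : Set Z) :=
    fun v hv t ht => smul_mem_characteristicCone hv ht
  obtain ⟨v₀, δ, hδ, hv₀⟩ := exists_interior_of_isCompact_dualSphere hcl' hconv' h0' hcone' hspan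
    (isCompact_dualSphere_subspace Z hVZ hK)
  by_cases hpoly : ∃ (n : ℕ) (g : Fin n → Z →L[ℝ] ℝ),
      ((↑) ⁻¹' V : Set Z) = {z | ∀ i, 0 ≤ g i z}
  · obtain ⟨n, g, hg⟩ := hpoly
    obtain ⟨m, f, hf⟩ := exists_eq_setOf_forall_nonneg Z
      (Submodule.isClosed_topologicalClosure _) hVZ hK g hg
    by_cases hb : ∀ i, BddBelow (f i '' C)
    · refine Or.inl ⟨hf ▸ isPolyhedral_setOf_forall_nonneg f, ?_⟩
      choose β hβ using hb
      obtain ⟨α, hα⟩ := (Set.finite_range β).bddBelow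
      obtain ⟨R, hR⟩ := exists_hoffman_bound f α
      refine hausdorffEDist_lt_top_of_subset_characteristicCone hne Subset.rfl (R := R)
        fun c hc => ?_
      obtain ⟨v, hv, hcv⟩ := hR c fun i => (hα ⟨i, rfl⟩).trans (hβ i ⟨c, hc, rfl⟩)
      exact ⟨v, by rw [hf]; exact hv, hcv⟩
    · push Not at hb
      obtain ⟨i₀, hi₀⟩ := hb
      exact Or.inr (isInfinitelyHiding_of_polyhedral_of_not_bddBelow f hne hcl hconv hf hi₀)
  · obtain ⟨a, ha, hseg⟩ := exists_hidden_seq_of_interior hcl' hconv' h0' hcone' hδ hv₀ hpoly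
    refine Or.inr (isInfinitelyHiding_of_characteristicCone hne hcl hconv (fun n => (a n : X)) ha
      fun m n hmn => ?_)
    obtain ⟨_, ⟨p, q, hp, hq, hpq, rfl⟩, hz⟩ := hseg m n hmn
    exact ⟨_, ⟨p, q, hp, hq, hpq, rfl⟩, hz⟩

end CompactDual

section BarrierCone

variable {X : Type*} [NormedAddCommGroup X] [NormedSpace ℝ X]

/-! ### Functionals bounded below on a convex set -/

/-- The unit sphere of the cone of functionals that are bounded below on `C`. -/
def barrierSphere (C : Set X) : Set (X →L[ℝ] ℝ) := {g | BddBelow (g '' C) ∧ ‖g‖ = 1}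

theorem bddBelow_image_iff {C : Set X} {g : X →L[ℝ] ℝ} :
    BddBelow (g '' C) ↔ ∃ b, ∀ c ∈ C, b ≤ g c :=
  ⟨fun ⟨b, hb⟩ => ⟨b, fun _ hc => hb ⟨_, hc, rfl⟩⟩,
    fun ⟨b, hb⟩ => ⟨b, by rintro _ ⟨c, hc, rfl⟩; exact hb c hc⟩⟩

theorem mem_characteristicCone_of_forall_barrier {C : Set X} (hcl : IsClosed C)
    (hconv : Convex ℝ C) {x : X} (hx : ∀ g : X →L[ℝ] ℝ, BddBelow (g '' C) → 0 ≤ g x) :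
    x ∈ characteristicCone C := by
  intro c hc t ht
  by_contra hmem
  obtain ⟨g, s, h1, h2⟩ := geometric_hahn_banach_point_closed hconv hcl hmem
  have h3 := hx g (bddBelow_image_iff.2 ⟨s, fun y hy => (h2 y hy).le⟩)
  have h4 := h2 c hc
  rw [map_add, map_smul, smul_eq_mul] at h1
  have := mul_nonneg ht h3
  linarith

/-- The functionals bounded below on `C` are weak-* dense in the dual cone of the characteristic
cone. -/
theorem mem_closure_barrier {C : Set X} (hcl : IsClosed C) (hconv : Convex ℝ C)
    {f : WeakDual ℝ X} (hf : ∀ v ∈ characteristicCone C, 0 ≤ f v) :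
    f ∈ closure {g : WeakDual ℝ X | ∃ b, ∀ c ∈ C, b ≤ g c} := by
  set W : Set (WeakDual ℝ X) := {g | ∃ b, ∀ c ∈ C, b ≤ g c} with hW
  have hWconv : Convex ℝ W := by
    rintro g ⟨b, hb⟩ g' ⟨b', hb'⟩ s t hs ht _
    refine ⟨s * b + t * b', fun c hc => ?_⟩
    change _ ≤ s * g c + t * g' c
    exact add_le_add (mul_le_mul_of_nonneg_left (hb c hc) hs)
      (mul_le_mul_of_nonneg_left (hb' c hc) ht)
  by_contra hmem
  obtain ⟨l, u, h1, h2⟩ := geometric_hahn_banach_point_closed hWconv.closure isClosed_closure hmem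
  have hu : u < 0 := by simpa using h2 0 (subset_closure ⟨0, fun c _ => le_rfl⟩)
  obtain ⟨z, hz⟩ := exists_eq_eval l
  have hzV : z ∈ characteristicCone C := by
    refine mem_characteristicCone_of_forall_barrier hcl hconv fun g hg => ?_
    obtain ⟨b, hb⟩ := bddBelow_image_iff.1 hg
    by_contra! hneg
    have ht : 0 ≤ u / g z := div_nonneg_of_nonpos hu.le hneg.le
    have hmem : StrongDual.toWeakDual ((u / g z) • g) ∈ W :=
      ⟨u / g z * b, fun c hc => mul_le_mul_of_nonneg_left (hb c hc) ht⟩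
    have h3 := h2 _ (subset_closure hmem)
    rw [hz] at h3
    change u < u / g z * g z at h3
    rw [div_mul_cancel₀ _ hneg.ne] at h3
    exact lt_irrefl _ h3
  have := hf z hzV
  rw [hz] at h1
  linarith

theorem isClosed_dualSphere (V : Set X) : IsClosed (dualSphere V) := by
  have : dualSphere V = (⋂ v ∈ V, {f : X →L[ℝ] ℝ | 0 ≤ f v}) ∩ {f | ‖f‖ = 1} := by
    ext f
    simp [dualSphere]
  rw [this]
  exact (isClosed_biInter fun v _ => isClosed_le continuous_const (by fun_prop)).inter
    (isClosed_eq continuous_norm continuous_const)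

/-- If the functionals of norm one bounded below on `C` form a totally bounded set, then the dual
cone of the characteristic cone has a compact unit sphere: along an ultrafilter converging weak-*,
the normalized functionals converge in norm. -/
theorem isCompact_dualSphere_of_totallyBounded {C : Set X} (hcl : IsClosed C)
    (hconv : Convex ℝ C) (hT : TotallyBounded (barrierSphere C)) :
    IsCompact (dualSphere (characteristicCone C)) := by
  have hKc : IsCompact (closure (barrierSphere C)) :=
    hT.closure.isCompact_of_isClosed isClosed_closure
  refine hKc.of_isClosed_subset (isClosed_dualSphere _) ?_
  rintro f ⟨hf, hf1⟩
  obtain ⟨U, hWU, hUf⟩ := mem_closure_iff_ultrafilter.1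
    (mem_closure_barrier hcl hconv (f := StrongDual.toWeakDual f) hf)
  have hev : ∀ x, Tendsto (fun g : WeakDual ℝ X => g x) U (𝓝 (f x)) := fun x =>
    ((WeakDual.eval_continuous x).tendsto (StrongDual.toWeakDual f)).mono_left hUf
  have hx₀ : ∃ x₀, f x₀ ≠ 0 := by
    by_contra! h
    have : f = 0 := ContinuousLinearMap.ext h
    simp [this] at hf1
  obtain ⟨x₀, hx₀⟩ := hx₀
  let ν : WeakDual ℝ X → ℝ := fun g => ‖WeakDual.toStrongDual g‖
  let N : WeakDual ℝ X → X →L[ℝ] ℝ := fun g => (ν g)⁻¹ • WeakDual.toStrongDual g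
  have hne : ∀ᶠ g in (U : Filter (WeakDual ℝ X)), ν g ≠ 0 := by
    filter_upwards [(hev x₀).eventually_ne hx₀] with g hg h0
    have : WeakDual.toStrongDual g = 0 := norm_eq_zero.1 h0
    exact hg (DFunLike.congr_fun this x₀)
  have hNmem : ∀ᶠ g in (U : Filter (WeakDual ℝ X)), N g ∈ closure (barrierSphere C) := by
    filter_upwards [hne, hWU] with g hg hgW
    obtain ⟨b, hb⟩ := hgW
    refine subset_closure ⟨bddBelow_image_iff.2 ⟨(ν g)⁻¹ * b, fun c hc => ?_⟩, ?_⟩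
    · exact mul_le_mul_of_nonneg_left (hb c hc) (inv_nonneg.2 (norm_nonneg _))
    · rw [norm_smul, norm_inv, Real.norm_of_nonneg (norm_nonneg _)]
      exact inv_mul_cancel₀ hg
  obtain ⟨p, hp, hNp⟩ := hKc.ultrafilter_le_nhds' (U.map N) hNmem
  have hNp' : Tendsto N U (𝓝 p) := hNp
  have hp1 : ‖p‖ = 1 := by
    have : closure (barrierSphere C) ⊆ Metric.sphere 0 1 :=
      closure_minimal (fun g hg => mem_sphere_zero_iff_norm.2 hg.2) Metric.isClosed_sphere
    exact mem_sphere_zero_iff_norm.1 (this hp)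
  have hNx : ∀ x, Tendsto (fun g => N g x) U (𝓝 (p x)) := fun x =>
    ((ContinuousLinearMap.apply ℝ ℝ x).continuous.tendsto p).comp hNp'
  have hmul : ∀ᶠ g in (U : Filter (WeakDual ℝ X)), ∀ x, g x = ν g * N g x := by
    filter_upwards [hne] with g hg x
    exact (mul_inv_cancel_left₀ hg (g x)).symm
  obtain ⟨y, hy⟩ : ∃ y, p y ≠ 0 := by
    by_contra! h
    have : p = 0 := ContinuousLinearMap.ext h
    simp [this] at hp1
  -- The norms converge because the values at `y` and their normalizations do.
  have hν : Tendsto ν U (𝓝 (f y / p y)) := by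
    refine ((hev y).div (hNx y) hy).congr' ?_
    filter_upwards [hmul, (hNx y).eventually_ne hy] with g hg hgy
    rw [Pi.div_apply, hg y, mul_div_cancel_right₀ _ hgy]
  have hfp : f = (f y / p y) • p := by
    ext x
    refine tendsto_nhds_unique (hev x) ((hν.mul (hNx x)).congr' ?_)
    filter_upwards [hmul] with g hg
    exact (hg x).symm
  have hr0 : 0 ≤ f y / p y := ge_of_tendsto' hν fun g => norm_nonneg _
  have hr1 : f y / p y = 1 := by
    have h := congrArg norm hfp
    rw [hf1, norm_smul, hp1, mul_one, Real.norm_of_nonneg hr0] at h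
    exact h.symm
  rw [hr1, one_smul] at hfp
  rwa [hfp]

end BarrierCone

section Biorthogonal

variable {X : Type*} [NormedAddCommGroup X] [NormedSpace ℝ X]

/-! ### Almost biorthogonal sequences and positively hiding sets -/

theorem totallyBounded_setOf_linear_combination {E ι : Type*} [NormedAddCommGroup E]
    [NormedSpace ℝ E] [Fintype ι] (b : ι → E) (R : ℝ) :
    TotallyBounded {e : E | (∃ c : ι → ℝ, e = ∑ i, c i • b i) ∧ ‖e‖ ≤ R} := by
  let N := Submodule.span ℝ (range b)
  have : FiniteDimensional ℝ N := FiniteDimensional.span_of_finite ℝ (Set.finite_range b)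
  have : ProperSpace N := FiniteDimensional.proper_real N
  refine ((isCompact_closedBall (0 : N) R).image continuous_subtype_val).totallyBounded.subset ?_
  rintro e ⟨⟨c, rfl⟩, he⟩
  refine ⟨⟨_, Submodule.sum_mem _ fun i _ => Submodule.smul_mem _ (c i)
    (Submodule.subset_span ⟨i, rfl⟩)⟩, ?_, rfl⟩
  rw [mem_closedBall_zero_iff]
  exact he

/-- A functional that is small on the common kernel of finitely many functionals is close to a
linear combination of them. -/
theorem exists_linear_combination_near {ι : Type*} [Fintype ι] (b : ι → X →L[ℝ] ℝ)
    (g : X →L[ℝ] ℝ) {η : ℝ} (hη : 0 ≤ η)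
    (h : ∀ u, ‖u‖ ≤ 1 → (∀ i, b i u = 0) → g u ≤ η) :
    ∃ c : ι → ℝ, ‖g - ∑ i, c i • b i‖ ≤ η := by
  let N : Submodule ℝ X := ⨅ i, LinearMap.ker (b i : X →ₗ[ℝ] ℝ)
  have hN : ∀ x, x ∈ N ↔ ∀ i, b i x = 0 := fun x => by simp [N, Submodule.mem_iInf]
  obtain ⟨g₁, hg₁, hnorm⟩ := exists_extension_norm_eq N (g.comp N.subtypeL)
  have hle : ‖g₁‖ ≤ η := by
    rw [hnorm]
    refine ContinuousLinearMap.opNorm_le_of_unit_norm hη fun u hu => ?_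
    have hu' : ‖(u : X)‖ ≤ 1 := hu.le
    refine abs_le.2 ⟨?_, h u hu' ((hN _).1 u.2)⟩
    have := h (-u) (by rwa [norm_neg]) ((hN _).1 (N.neg_mem u.2))
    rw [map_neg] at this
    change -η ≤ g u
    linarith
  have hker : (⨅ i, LinearMap.ker (b i : X →ₗ[ℝ] ℝ)) ≤
      LinearMap.ker ((g - g₁ : X →L[ℝ] ℝ) : X →ₗ[ℝ] ℝ) := by
    intro x hx
    have := hg₁ ⟨x, hx⟩
    change g x - g₁ x = 0
    rw [sub_eq_zero]
    exact this.symm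
  obtain ⟨c, hc⟩ := (Submodule.mem_span_range_iff_exists_fun ℝ).1 (mem_span_of_iInf_ker_le_ker hker)
  refine ⟨c, le_trans (le_of_eq ?_) hle⟩
  congr 1
  ext x
  have := LinearMap.congr_fun hc x
  simp at this ⊢
  linarith

/-- If `T` is not totally bounded, then for every finite set of functionals some element of `T` is
bounded away from zero on the unit ball of their common kernel, since otherwise `T` would be covered
by small balls around a bounded subset of their span. Iterating gives a triangular system. -/
theorem exists_seq_eval_zero {T : Set (X →L[ℝ] ℝ)} (hT1 : ∀ g ∈ T, ‖g‖ = 1)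
    (hT : ¬ TotallyBounded T) : ∃ (η : ℝ) (g : ℕ → X →L[ℝ] ℝ) (u : ℕ → X), 0 < η ∧
      (∀ n, g n ∈ T) ∧ (∀ n, ‖u n‖ ≤ 1) ∧ (∀ n, η ≤ g n (u n)) ∧
      ∀ m n, m < n → g m (u n) = 0 := by
  rw [Metric.totallyBounded_iff] at hT
  push Not at hT
  obtain ⟨ε, hε, hnet⟩ := hT
  have hstep : ∀ G : Finset ((X →L[ℝ] ℝ) × X), ∃ (g : X →L[ℝ] ℝ) (u : X), g ∈ T ∧ ‖u‖ ≤ 1 ∧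
      ε / 4 ≤ g u ∧ ∀ p ∈ G, p.1 u = 0 := by
    intro G
    by_contra! hcon
    let b : G → X →L[ℝ] ℝ := fun p => p.1.1
    obtain ⟨t, ht, hcover⟩ := Metric.totallyBounded_iff.1
      (totallyBounded_setOf_linear_combination b (1 + ε / 4)) (ε / 2) (by positivity)
    refine hnet t ht fun g hg => ?_
    obtain ⟨c, hc⟩ := exists_linear_combination_near b g (η := ε / 4) (by positivity)
      fun u hu hub => by
        by_contra! hlt
        obtain ⟨p, hp, hpu⟩ := hcon g u hg hu hlt.le
        exact hpu (hub ⟨p, hp⟩)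
    have hmem : ∑ i, c i • b i ∈ {e : X →L[ℝ] ℝ | (∃ c : G → ℝ, e = ∑ i, c i • b i) ∧
        ‖e‖ ≤ 1 + ε / 4} := by
      refine ⟨⟨c, rfl⟩, ?_⟩
      calc ‖∑ i, c i • b i‖ = ‖g - (g - ∑ i, c i • b i)‖ := by rw [sub_sub_cancel]
        _ ≤ ‖g‖ + ‖g - ∑ i, c i • b i‖ := norm_sub_le _ _
        _ ≤ 1 + ε / 4 := add_le_add (hT1 g hg).le hc
    obtain ⟨y, hy, hgy⟩ := mem_iUnion₂.1 (hcover hmem)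
    refine mem_iUnion₂.2 ⟨y, hy, ?_⟩
    rw [Metric.mem_ball] at hgy ⊢
    calc dist g y ≤ dist g (∑ i, c i • b i) + dist (∑ i, c i • b i) y := dist_triangle _ _ _
      _ < ε / 4 + ε / 2 := add_lt_add_of_le_of_lt (by rwa [dist_eq_norm]) hgy
      _ ≤ ε := by linarith
  obtain ⟨s, hs1, hs2⟩ := exists_seq_of_forall_finset_exists
    (fun p : (X →L[ℝ] ℝ) × X => p.1 ∈ T ∧ ‖p.2‖ ≤ 1 ∧ ε / 4 ≤ p.1 p.2)
    (fun p q => p.1 q.2 = 0) fun G _ => by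
      obtain ⟨g, u, h1, h2, h3, h4⟩ := hstep G
      exact ⟨(g, u), ⟨h1, h2, h3⟩, h4⟩
  exact ⟨ε / 4, fun n => (s n).1, fun n => (s n).2, by positivity, fun n => (hs1 n).1,
    fun n => (hs1 n).2.1, fun n => (hs1 n).2.2, fun m n hmn => hs2 m n hmn⟩

/-- A bounded triangular array has a sub-array whose entries below the diagonal are nearly
constant. -/
theorem exists_subseq_nearly_constant {A : ℕ → ℕ → ℝ} {M : ℝ} (hA : ∀ m n, |A m n| ≤ M) {ε : ℝ}
    (hε : 0 < ε) : ∃ (l : ℝ) (φ : ℕ → ℕ), StrictMono φ ∧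
      ∀ i k, i < k → |A (φ i) (φ k) - l| < ε := by
  have hlim : ∀ x : ℕ → ℝ, (∀ n, |x n| ≤ M) →
      ∃ L, |L| ≤ M ∧ Tendsto x (hyperfilter ℕ : Filter ℕ) (𝓝 L) := by
    intro x hx
    obtain ⟨L, hL, h⟩ := (isCompact_Icc (a := -M) (b := M)).ultrafilter_le_nhds'
      ((hyperfilter ℕ).map x) (Filter.Eventually.of_forall (f := (hyperfilter ℕ : Filter ℕ))
        fun k => abs_le.1 (hx k))
    exact ⟨L, abs_le.2 hL, h⟩
  choose L hLM hL using fun m => hlim (A m) (hA m)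
  obtain ⟨l, -, hl⟩ := hlim L hLM
  have hnear : ∀ {x : ℕ → ℝ} {y : ℝ}, Tendsto x (hyperfilter ℕ : Filter ℕ) (𝓝 y) →
      ∀ᶠ n in (hyperfilter ℕ : Filter ℕ), |x n - y| < ε / 2 := fun h =>
    (Metric.tendsto_nhds.1 h) (ε / 2) (by positivity)
  obtain ⟨φ, hφ1, hφ2⟩ := exists_seq_of_forall_finset_exists (fun m => |L m - l| < ε / 2)
    (fun m n => m < n ∧ |A m n - L m| < ε / 2) fun s _ => by
      have h1 : ∀ᶠ n in (hyperfilter ℕ : Filter ℕ), ∀ m ∈ s, m < n ∧ |A m n - L m| < ε / 2 := by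
        refine (Filter.eventually_all_finset s).2 fun m _ => ?_
        exact ((eventually_gt_atTop m).filter_mono Nat.hyperfilter_le_atTop).and (hnear (hL m))
      obtain ⟨n, hn1, hn2⟩ := ((hnear hl).and h1).exists
      exact ⟨n, hn1, hn2⟩
  refine ⟨l, φ, strictMono_nat_of_lt_succ fun n => (hφ2 n (n + 1) n.lt_succ_self).1,
    fun i k hik => ?_⟩
  have h1 := (hφ2 i k hik).2
  have h2 := hφ1 i
  calc |A (φ i) (φ k) - l| = |(A (φ i) (φ k) - L (φ i)) + (L (φ i) - l)| := by congr 1; ring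
    _ ≤ |A (φ i) (φ k) - L (φ i)| + |L (φ i) - l| := abs_add_le _ _
    _ < ε := by linarith

/-- A set of unit functionals that is not totally bounded contains an almost biorthogonal
sequence. -/
theorem exists_almost_biorthogonal {T : Set (X →L[ℝ] ℝ)} (hT1 : ∀ g ∈ T, ‖g‖ = 1)
    (hT : ¬ TotallyBounded T) : ∃ (η : ℝ) (ψ : ℕ → X →L[ℝ] ℝ) (z : ℕ → X), 0 < η ∧
      (∀ n, ψ n ∈ T) ∧ (∀ n, ‖z n‖ ≤ 2) ∧ (∀ n, η ≤ ψ n (z n)) ∧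
      ∀ m n, m ≠ n → |ψ m (z n)| ≤ η / 4 := by
  obtain ⟨η, g, u, hη, hg, hu, hgu, h0⟩ := exists_seq_eval_zero hT1 hT
  have hA : ∀ m n, |g n (u m)| ≤ 1 := by
    intro m n
    calc ‖g n (u m)‖ ≤ ‖g n‖ * ‖u m‖ := (g n).le_opNorm _
      _ ≤ 1 := by rw [hT1 _ (hg n), one_mul]; exact hu m
  obtain ⟨l, φ, hφ, hl⟩ := exists_subseq_nearly_constant hA (ε := η / 8) (by positivity)
  -- Differences of consecutive vectors cancel the common limit `l`.
  refine ⟨η, fun j => g (φ (2 * j)), fun j => u (φ (2 * j)) - u (φ (2 * j + 1)), hη,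
    fun n => hg _, fun n => ?_, fun n => ?_, fun m n hmn => ?_⟩
  · exact (norm_sub_le _ _).trans (by linarith [hu (φ (2 * n)), hu (φ (2 * n + 1))])
  · rw [map_sub, h0 (φ (2 * n)) (φ (2 * n + 1)) (hφ (by omega)), sub_zero]
    exact hgu _
  · rw [map_sub]
    rcases hmn.lt_or_gt with h | h
    · rw [h0 _ _ (hφ (by omega)), h0 _ _ (hφ (by omega)), sub_zero, abs_zero]
      positivity
    · have h1 := abs_lt.1 (hl (2 * n) (2 * m) (by omega))
      have h2 := abs_lt.1 (hl (2 * n + 1) (2 * m) (by omega))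
      exact abs_le.2 ⟨by linarith, by linarith⟩

theorem isPositivelyHiding_of_seq {C : Set X} {a : ℕ → X} (ha : Function.Injective a) {δ : ℝ}
    (hδ : 0 < δ) (hdist : ∀ n, ∀ y ∈ C, δ ≤ ‖a n - y‖)
    (hseg : ∀ m n, m ≠ n → (segment ℝ (a m) (a n) ∩ C).Nonempty) : IsPositivelyHiding C := by
  refine ⟨range a, infinite_range_of_injective ha, ?_, ?_, ?_⟩
  · rintro _ ⟨n, rfl⟩ h
    have := hdist n _ h
    rw [sub_self, norm_zero] at this
    linarith
  · rintro _ ⟨m, rfl⟩ _ ⟨n, rfl⟩ hmn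
    exact hseg m n fun h => hmn (h ▸ rfl)
  · refine (ENNReal.ofReal_pos.2 hδ).trans_le (le_iInf₂ ?_)
    rintro _ ⟨n, rfl⟩
    rw [Metric.le_infEDist]
    intro y hy
    rw [edist_dist, dist_eq_norm]
    exact ENNReal.ofReal_le_ofReal (hdist n y hy)

/-- If the functionals of norm one bounded below on `C` do not form a totally bounded set, then
some closed convex set near `C` is positively hiding: push points out of `C` at near-minimizers of
an almost biorthogonal sequence, and add the midpoints of the resulting points. -/
theorem exists_isPositivelyHiding_of_not_totallyBounded {C : Set X} (hne : C.Nonempty)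
    (hconv : Convex ℝ C) (hT : ¬ TotallyBounded (barrierSphere C)) :
    ∃ P ∈ hausdorffComponent C, IsPositivelyHiding (P.1 : Set X) := by
  obtain ⟨η, ψ, z, hη, hψ, hz, hψz, hoff⟩ := exists_almost_biorthogonal (fun g hg => hg.2) hT
  have hmin : ∀ n, ∃ c ∈ C, ∀ y ∈ C, ψ n c - η / 8 ≤ ψ n y := by
    intro n
    obtain ⟨_, ⟨c, hc, rfl⟩, h⟩ := exists_lt_of_csInf_lt (hne.image (ψ n))
      (lt_add_of_pos_right (sInf (ψ n '' C)) (show 0 < η / 8 by positivity))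
    refine ⟨c, hc, fun y hy => ?_⟩
    have := csInf_le (hψ n).1 ⟨y, hy, rfl⟩
    linarith
  choose c hcC hc using hmin
  set a : ℕ → X := fun n => c n - z n with ha
  have haC : ∀ n, ∀ y ∈ C, ψ n (a n) + 7 * η / 8 ≤ ψ n y := by
    intro n y hy
    have h1 := hc n y hy
    have h2 := hψz n
    rw [ha, map_sub]
    linarith
  have haa : ∀ n i, i ≠ n → ψ n (a n) + 5 * η / 8 ≤ ψ n (a i) := by
    intro n i hin
    have h1 := haC n (c i) (hcC i)
    have h2 := (abs_le.1 (hoff n i hin.symm)).2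
    have h3 : ψ n (a i) = ψ n (c i) - ψ n (z i) := by rw [ha, map_sub]
    linarith
  let Q : Set X := C ∪ {x | ∃ i j, i ≠ j ∧ x = midpoint ℝ (a i) (a j)}
  have hQC : convexHull ℝ Q ⊆ {x | ∃ y ∈ C, ‖x - y‖ ≤ 2} := by
    refine convexHull_min ?_ (convex_setOf_exists_norm_sub_le hconv 2)
    rintro x (hx | ⟨i, j, -, rfl⟩)
    · exact ⟨x, hx, by simp⟩
    · refine ⟨midpoint ℝ (c i) (c j), hconv.midpoint_mem (hcC i) (hcC j), ?_⟩
      have : midpoint ℝ (a i) (a j) - midpoint ℝ (c i) (c j) = -((1 / 2 : ℝ) • (z i + z j)) := by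
        rw [midpoint_eq_smul_add, midpoint_eq_smul_add, ha]
        simp only [invOf_eq_inv]
        module
      rw [this, norm_neg, norm_smul]
      have := norm_add_le (z i) (z j)
      have := hz i
      have := hz j
      norm_num
      linarith
  have hCQ : C ⊆ convexHull ℝ Q := subset_union_left.trans (subset_convexHull ℝ Q)
  have hψQ : ∀ n, convexHull ℝ Q ⊆ {x | ψ n (a n) + η / 4 ≤ ψ n x} := by
    intro n
    refine convexHull_min ?_ (convex_halfSpace_ge (ψ n).isLinear _)
    rintro x (hx | ⟨i, j, hij, rfl⟩)
    · have := haC n x hx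
      rw [mem_ofPred_eq]
      linarith
    · have h1 : ∀ i, ψ n (a n) ≤ ψ n (a i) := fun i => by
        rcases eq_or_ne i n with rfl | h
        · exact le_rfl
        · have := haa n i h
          linarith
      have h2 : ψ n (midpoint ℝ (a i) (a j)) = (ψ n (a i) + ψ n (a j)) / 2 := by
        rw [midpoint_eq_smul_add, map_smul, map_add, smul_eq_mul, invOf_eq_inv]
        ring
      rw [mem_ofPred_eq, h2]
      rcases eq_or_ne i n with h | h
      · have := haa n j (by rintro rfl; exact hij h)
        have := h1 i
        linarith
      · have := haa n i h
        have := h1 j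
        linarith
  have hQne : (convexHull ℝ Q).Nonempty := hne.mono hCQ
  refine ⟨closureConvH (convexHull ℝ Q) hQne (convex_convexHull ℝ Q), ?_, ?_⟩
  · rw [closureConvH_mem_hausdorffComponent_iff]
    refine (hausdorffEDist_le_ofReal (R := 2) (fun x hx => hQC hx)
      fun y hy => ⟨y, hCQ hy, by simp⟩).trans_lt ENNReal.ofReal_lt_top
  · have hψcl : ∀ n, closure (convexHull ℝ Q) ⊆ {x | ψ n (a n) + η / 4 ≤ ψ n x} := fun n =>
      closure_minimal (hψQ n) (isClosed_le continuous_const (ψ n).continuous)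
    rw [coe_closureConvH]
    refine isPositivelyHiding_of_seq (a := a) (δ := η / 4) (fun i j hij => ?_) (by positivity)
      (fun n y hy => ?_) fun m n hmn => ?_
    · by_contra h
      have := haa j i h
      rw [hij] at this
      linarith
    · have h1 : ψ n (a n) + η / 4 ≤ ψ n y := hψcl n hy
      have h2 : ‖ψ n (a n - y)‖ ≤ 1 * ‖a n - y‖ := by
        rw [← (hψ n).2]
        exact (ψ n).le_opNorm _
      rw [map_sub, one_mul] at h2
      have := (abs_le.1 h2).1
      linarith
    · exact ⟨midpoint ℝ (a m) (a n), midpoint_mem_segment _ _,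
        subset_closure (subset_convexHull ℝ Q (Or.inr ⟨m, n, hmn, rfl⟩))⟩

end Biorthogonal

section Density

variable {X : Type*} [NormedAddCommGroup X] [NormedSpace ℝ X]

/-! ### Positively hiding sets force a large density -/

/-- A positively hiding set yields infinitely many points at a bounded positive distance, each
strictly separated by a functional from the set and from all the other points. -/
theorem exists_separated_seq {P : Set X} (hne : P.Nonempty) (hconv : Convex ℝ P)
    (hP : IsPositivelyHiding P) : ∃ (ε : ℝ) (b : ℕ → X) (f : ℕ → X →L[ℝ] ℝ) (u : ℕ → ℝ), 0 < ε ∧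
      (∀ n, ∃ y ∈ P, ‖b n - y‖ ≤ 2 * ε) ∧ (∀ n, ∀ x, ‖b n - x‖ < ε → f n x < u n) ∧
      (∀ n, ∀ y ∈ P, u n ≤ f n y) ∧ ∀ n m, m ≠ n → u n ≤ f n (b m) := by
  obtain ⟨A, hAinf, -, hAh, hAd⟩ := hP
  obtain ⟨δ, hδ, hδA⟩ := ENNReal.lt_iff_exists_nnreal_btwn.1 hAd
  obtain ⟨ε, hε⟩ : ∃ ε : ℝ, ε = (δ : ℝ) := ⟨_, rfl⟩
  have hε0 : 0 < ε := by
    rw [hε]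
    exact_mod_cast hδ
  have hAε : ∀ a ∈ A, ε ≤ Metric.infDist a P := by
    intro a ha
    refine (ENNReal.ofReal_le_iff_le_toReal (Metric.infEDist_ne_top hne)).1 ?_
    rw [hε, ENNReal.ofReal_coe_nnreal]
    exact hδA.le.trans (iInf₂_le a ha)
  let a : ℕ → X := fun n => hAinf.natEmbedding A n
  have haA : ∀ n, a n ∈ A := fun n => (hAinf.natEmbedding A n).2
  have hinj : Function.Injective a := fun m n h =>
    (hAinf.natEmbedding A).injective (Subtype.ext h)
  obtain ⟨p, hp⟩ := hne
  have hτ : ∀ n, ∃ τ ∈ Icc (0 : ℝ) 1, Metric.infDist (p + τ • (a n - p)) P = ε := by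
    intro n
    have hcont : ContinuousOn (fun τ : ℝ => Metric.infDist (p + τ • (a n - p)) P) (Icc 0 1) :=
      ((Metric.continuous_infDist_pt P).comp (by fun_prop)).continuousOn
    refine intermediate_value_Icc zero_le_one hcont ⟨?_, ?_⟩
    · simp only [zero_smul, add_zero, Metric.infDist_zero_of_mem hp]
      exact hε0.le
    · simpa using hAε _ (haA n)
  choose τ hτ01 hτε using hτ
  set b : ℕ → X := fun n => p + τ n • (a n - p) with hb
  have hfar : ∀ n, ∀ y ∈ P, ε ≤ ‖b n - y‖ := fun n y hy => by
    rw [← dist_eq_norm, ← hτε n]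
    exact Metric.infDist_le_dist_of_mem hy
  have hdisj : ∀ n, Disjoint (Metric.ball (b n) ε) P := fun n => by
    rw [Set.disjoint_left]
    intro x hx hxP
    have := hfar n x hxP
    rw [Metric.mem_ball', dist_eq_norm] at hx
    linarith
  choose f u hf1 hf2 using fun n =>
    geometric_hahn_banach_open (convex_ball (b n) ε) Metric.isOpen_ball hconv (hdisj n)
  have hfb : ∀ n m, f n (b m) = (1 - τ m) * f n p + τ m * f n (a m) := fun n m => by
    rw [hb, map_add, map_smul, map_sub, smul_eq_mul]
    ring
  have hbn : ∀ n, f n (b n) < u n := fun n => hf1 n _ (Metric.mem_ball_self hε0)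
  have han : ∀ n, f n (a n) < u n := by
    intro n
    by_contra! h
    have h1 := hbn n
    rw [hfb] at h1
    nlinarith [mul_le_mul_of_nonneg_left (hf2 n p hp) (sub_nonneg.2 (hτ01 n).2),
      mul_le_mul_of_nonneg_left h (hτ01 n).1]
  refine ⟨ε, b, f, u, hε0, fun n => ?_, fun n x hx => hf1 n x ?_, hf2, fun n m hmn => ?_⟩
  · obtain ⟨y, hy, h⟩ := (Metric.infDist_lt_iff (x := b n) ⟨p, hp⟩).1
      (show Metric.infDist (b n) P < 2 * ε by rw [hτε n]; linarith)
    exact ⟨y, hy, by rw [← dist_eq_norm]; exact h.le⟩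
  · rwa [Metric.mem_ball', dist_eq_norm]
  · have hmu : u n ≤ f n (a m) := by
      by_contra! h
      obtain ⟨_, ⟨s, t, hs, ht, hst, rfl⟩, hx⟩ := hAh _ (haA m) _ (haA n) fun h => hmn (hinj h)
      have h1 := hf2 n _ hx
      have h2 := convex_Iio (𝕜 := ℝ) (u n) h (han n) hs ht hst
      rw [map_add, map_smul, map_smul] at h1
      exact absurd h1 (not_le.2 h2)
    rw [hfb]
    nlinarith [mul_le_mul_of_nonneg_left (hf2 n p hp) (sub_nonneg.2 (hτ01 m).2),
      mul_le_mul_of_nonneg_left hmu (hτ01 m).1]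

/-- A positively hiding set in the component of `C` yields a uniformly discrete family of closed
convex sets in that component, indexed by the subsets of `ℕ`. -/
theorem exists_uniformly_discrete_family {C : Set X} {P : ConvH X} (hPC : P ∈ hausdorffComponent C)
    (hP : IsPositivelyHiding (P.1 : Set X)) :
    ∃ (ε : ℝ) (F : Set ℕ → hausdorffComponent C), 0 < ε ∧
      ∀ J K : Set ℕ, J ≠ K → ENNReal.ofReal ε ≤ edist (F J) (F K) := by
  obtain ⟨ε, b, f, u, hε, hb, hfb, hfP, hfo⟩ := exists_separated_seq P.2.1 P.2.2 hP
  let S : Set ℕ → Set X := fun J => convexHull ℝ ((P.1 : Set X) ∪ b '' J)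
  have hPS : ∀ J, (P.1 : Set X) ⊆ S J := fun J => subset_union_left.trans (subset_convexHull ℝ _)
  have hbS : ∀ J, ∀ n ∈ J, b n ∈ S J := fun J n hn =>
    subset_convexHull ℝ _ (Or.inr ⟨n, hn, rfl⟩)
  have hSP : ∀ J, S J ⊆ {x | ∃ y ∈ (P.1 : Set X), ‖x - y‖ ≤ 2 * ε} := by
    intro J
    refine convexHull_min ?_ (convex_setOf_exists_norm_sub_le P.2.2 _)
    rintro _ (hx | ⟨n, -, rfl⟩)
    · exact ⟨_, hx, by rw [sub_self, norm_zero]; positivity⟩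
    · exact hb n
  have hSne : ∀ J, (S J).Nonempty := fun J => P.2.1.mono (hPS J)
  have hSC : ∀ J, closureConvH (S J) (hSne J) (convex_convexHull ℝ _) ∈ hausdorffComponent C := by
    intro J
    rw [closureConvH_mem_hausdorffComponent_iff]
    have h1 : Metric.hausdorffEDist (S J) P.1 < ⊤ :=
      (hausdorffEDist_le_ofReal (R := 2 * ε) (hSP J) fun y hy =>
        ⟨y, hPS J hy, by rw [sub_self, norm_zero]; positivity⟩).trans_lt ENNReal.ofReal_lt_top
    exact Metric.hausdorffEDist_triangle.trans_lt (ENNReal.add_lt_top.2 ⟨h1, hPC⟩)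
  have key : ∀ J K : Set ℕ, ∀ n ∈ J, n ∉ K →
      ENNReal.ofReal ε ≤ Metric.hausdorffEDist (S J) (S K) := by
    intro J K n hnJ hnK
    by_contra! hlt
    obtain ⟨y, hy, hby⟩ := exists_norm_sub_lt_of_hausdorffEDist_lt hlt _ (hbS J n hnJ)
    have hK : S K ⊆ {x | u n ≤ f n x} := by
      refine convexHull_min ?_ (convex_halfSpace_ge (f n).isLinear _)
      rintro _ (hx | ⟨m, hm, rfl⟩)
      · exact hfP n _ hx
      · exact hfo n m fun h => hnK (h ▸ hm)
    exact absurd (hfb n y hby) (not_lt.2 (hK hy))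
  refine ⟨ε, fun J => ⟨_, hSC J⟩, hε, fun J K hJK => ?_⟩
  change _ ≤ Metric.hausdorffEDist (closure (S J)) (closure (S K))
  rw [Metric.hausdorffEDist_closure]
  by_cases h : J ⊆ K
  · obtain ⟨n, hnK, hnJ⟩ := Set.not_subset.1 fun h' => hJK (h.antisymm h')
    rw [Metric.hausdorffEDist_comm]
    exact key K J n hnK hnJ
  · obtain ⟨n, hnJ, hnK⟩ := Set.not_subset.1 h
    exact key J K n hnJ hnK

theorem continuum_le_topologicalDensity {C : Set X} {P : ConvH X} (hPC : P ∈ hausdorffComponent C)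
    (hP : IsPositivelyHiding (P.1 : Set X)) :
    Cardinal.continuum ≤ topologicalDensity (hausdorffComponent C) := by
  obtain ⟨ε, F, hε, hF⟩ := exists_uniformly_discrete_family hPC hP
  have : Nonempty {D : Set (hausdorffComponent C) // Dense D} := ⟨⟨univ, dense_univ⟩⟩
  refine le_ciInf fun D => ?_
  have hε2 : 0 < ENNReal.ofReal (ε / 2) := ENNReal.ofReal_pos.2 (by positivity)
  choose d hdD hd using fun J => EMetric.mem_closure_iff.1 (D.2 (F J)) _ hε2
  have hinj : Function.Injective fun J => (⟨d J, hdD J⟩ : D.1) := by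
    intro J K hJK
    have hdJK : d J = d K := congrArg Subtype.val hJK
    by_contra hne
    have h1 : edist (F J) (F K) < ENNReal.ofReal (ε / 2) + ENNReal.ofReal (ε / 2) := by
      refine (edist_triangle_right (F J) (F K) (d J)).trans_lt (ENNReal.add_lt_add (hd J) ?_)
      rw [hdJK]
      exact hd K
    rw [← ENNReal.ofReal_add (by positivity) (by positivity), add_halves] at h1
    exact absurd h1 (not_lt.2 (hF J K hne))
  have h := Cardinal.lift_mk_le_lift_mk_of_injective hinj
  rwa [Cardinal.mk_set_nat, Cardinal.lift_continuum, Cardinal.lift_id'] at h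

end Density

section Equivalences

variable {X : Type*} [NormedAddCommGroup X] [NormedSpace ℝ X]

/-! ### The equivalences -/

theorem _root_.IsInfinitelyHiding.isPositivelyHiding {C : Set X} (hne : C.Nonempty)
    (h : IsInfinitelyHiding C) : IsPositivelyHiding C := by
  obtain ⟨A, -, hAC, hAh, hAd⟩ := h
  refine ⟨{a ∈ A | 1 ≤ Metric.infEDist a C}, fun hfin => ?_, fun a ha => hAC ha.1,
    fun a ha b hb => hAh a ha.1 b hb.1, one_pos.trans_le (le_iInf₂ fun a ha => ha.2)⟩
  -- Otherwise the distances from the points of `A` to `C` are bounded.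
  have hlt : max 1 (∑ a ∈ hfin.toFinset, Metric.infEDist a C) < ⊤ :=
    max_lt ENNReal.one_lt_top
      (ENNReal.sum_lt_top.2 fun a _ => lt_top_iff_ne_top.2 (Metric.infEDist_ne_top hne))
  refine ((iSup₂_le fun a ha => ?_).trans_lt hlt).ne hAd
  by_cases h1 : 1 ≤ Metric.infEDist a C
  · refine le_max_of_le_right ?_
    exact Finset.single_le_sum (f := fun a => Metric.infEDist a C) (fun _ _ => zero_le)
      (hfin.mem_toFinset.2 ⟨ha, h1⟩)
  · exact le_max_of_le_left (not_le.1 h1).le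

theorem isCompact_dualSphere_of_finiteDimensional [FiniteDimensional ℝ X] (V : Set X) :
    IsCompact (dualSphere V) := by
  have : ProperSpace (X →L[ℝ] ℝ) := FiniteDimensional.proper_real _
  exact (isCompact_sphere (0 : X →L[ℝ] ℝ) 1).of_isClosed_subset (isClosed_dualSphere V)
    fun f hf => mem_sphere_zero_iff_norm.2 hf.2

theorem polyhedral_of_forall_not_isPositivelyHiding [CompleteSpace X] {C : Set X}
    (hne : C.Nonempty) (hcl : IsClosed C) (hconv : Convex ℝ C)
    (h : ∀ P ∈ hausdorffComponent C, ¬ IsPositivelyHiding (P.1 : Set X)) :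
    IsPolyhedral (characteristicCone C) ∧
      Metric.hausdorffEDist C (characteristicCone C) < ⊤ := by
  have hT : TotallyBounded (barrierSphere C) := by
    by_contra hT
    obtain ⟨P, hP, hPh⟩ := exists_isPositivelyHiding_of_not_totallyBounded hne hconv hT
    exact h P hP hPh
  refine (polyhedral_or_isInfinitelyHiding hne hcl hconv
    (isCompact_dualSphere_of_totallyBounded hcl hconv hT)).resolve_right fun hinf => ?_
  refine h ⟨⟨C, hcl⟩, hne, hconv⟩ ?_ (hinf.isPositivelyHiding hne)
  rw [mem_hausdorffComponent_iff]
  exact Metric.hausdorffEDist_self.trans_lt ENNReal.zero_lt_top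

end Equivalences

end HiddenPolyhedra

open HiddenPolyhedra

theorem theorem1p1 {X : Type*} [NormedAddCommGroup X] [NormedSpace ℝ X] [CompleteSpace X]
    (C : Set X) (hne : C.Nonempty) (hclosed : IsClosed C) (hconv : Convex ℝ C) :
    List.TFAE
      [ IsApproxPolyhedral C,
        IsPolyhedral (characteristicCone C) ∧
          Metric.hausdorffEDist C (characteristicCone C) < ⊤,
        ∃ P ∈ hausdorffComponent C, IsPolyhedral (P.1 : Set X),
        ∀ P ∈ hausdorffComponent C, ¬ IsPositivelyHiding (P.1 : Set X),
        SeparableSpace (hausdorffComponent C),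
        topologicalDensity (hausdorffComponent C) < Cardinal.continuum ] ∧
    (FiniteDimensional ℝ X →
      List.TFAE
        [ IsApproxPolyhedral C,
          IsPolyhedral (characteristicCone C) ∧
            Metric.hausdorffEDist C (characteristicCone C) < ⊤,
          ∃ P ∈ hausdorffComponent C, IsPolyhedral (P.1 : Set X),
          ∀ P ∈ hausdorffComponent C, ¬ IsPositivelyHiding (P.1 : Set X),
          SeparableSpace (hausdorffComponent C),
          topologicalDensity (hausdorffComponent C) < Cardinal.continuum,
          ¬ IsPositivelyHiding C,
          ¬ IsInfinitelyHiding C ]) := by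
  have h13 : IsApproxPolyhedral C → ∃ P ∈ hausdorffComponent C, IsPolyhedral (P.1 : Set X) := by
    intro h
    obtain ⟨P, hP, hCP⟩ := h 1 one_pos
    have hlt : Metric.hausdorffEDist C P < ⊤ := hCP.trans ENNReal.ofReal_lt_top
    refine ⟨⟨⟨P, hP.isClosed⟩, Metric.nonempty_of_hausdorffEDist_ne_top hne hlt.ne, hP.convex⟩,
      ?_, hP⟩
    rw [Metric.hausdorffEDist_comm] at hlt
    exact hlt
  have h3 : (∃ P ∈ hausdorffComponent C, IsPolyhedral (P.1 : Set X)) → ∃ (n : ℕ)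
      (f : Fin n → X →L[ℝ] ℝ), characteristicCone C = {v | ∀ i, 0 ≤ f i v} ∧
      Metric.hausdorffEDist C {v | ∀ i, 0 ≤ f i v} < ⊤ := by
    rintro ⟨P, hPC, hP⟩
    exact characteristicCone_eq_of_polyhedral_near hne hclosed hconv hP hPC
  have h32 : (∃ P ∈ hausdorffComponent C, IsPolyhedral (P.1 : Set X)) →
      IsPolyhedral (characteristicCone C) ∧
        Metric.hausdorffEDist C (characteristicCone C) < ⊤ := by
    intro h
    obtain ⟨n, f, hV, hCV⟩ := h3 h
    rw [hV]
    exact ⟨isPolyhedral_setOf_forall_nonneg f, hCV⟩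
  have h23 : IsPolyhedral (characteristicCone C) ∧
      Metric.hausdorffEDist C (characteristicCone C) < ⊤ →
        ∃ P ∈ hausdorffComponent C, IsPolyhedral (P.1 : Set X) := by
    rintro ⟨hV, hCV⟩
    refine ⟨⟨⟨_, isClosed_characteristicCone hclosed⟩, ⟨0, zero_mem_characteristicCone C⟩,
      convex_characteristicCone C⟩, ?_, hV⟩
    rw [Metric.hausdorffEDist_comm] at hCV
    exact hCV
  have h31 : (∃ P ∈ hausdorffComponent C, IsPolyhedral (P.1 : Set X)) → IsApproxPolyhedral C := by
    intro h
    obtain ⟨n, f, -, hCV⟩ := h3 h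
    exact isApproxPolyhedral_of_near f hne hclosed hconv hCV
  have h35 : (∃ P ∈ hausdorffComponent C, IsPolyhedral (P.1 : Set X)) →
      SeparableSpace (hausdorffComponent C) := by
    intro h
    obtain ⟨n, f, -, hCV⟩ := h3 h
    exact separableSpace_hausdorffComponent f hCV
  have h56 : SeparableSpace (hausdorffComponent C) →
      topologicalDensity (hausdorffComponent C) < Cardinal.continuum := fun _ =>
    topologicalDensity_lt_continuum _
  have h64 : topologicalDensity (hausdorffComponent C) < Cardinal.continuum →
      ∀ P ∈ hausdorffComponent C, ¬ IsPositivelyHiding (P.1 : Set X) := fun h P hPC hP =>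
    absurd h (not_lt.2 (continuum_le_topologicalDensity hPC hP))
  have h42 := polyhedral_of_forall_not_isPositivelyHiding hne hclosed hconv
  constructor
  · tfae_have 1 → 3 := h13
    tfae_have 3 → 2 := h32
    tfae_have 2 → 3 := h23
    tfae_have 3 → 1 := h31
    tfae_have 3 → 5 := h35
    tfae_have 5 → 6 := h56
    tfae_have 6 → 4 := h64
    tfae_have 4 → 2 := h42
    tfae_finish
  · intro _
    tfae_have 1 → 3 := h13
    tfae_have 3 → 2 := h32
    tfae_have 2 → 3 := h23
    tfae_have 3 → 1 := h31
    tfae_have 3 → 5 := h35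
    tfae_have 5 → 6 := h56
    tfae_have 6 → 4 := h64
    tfae_have 4 → 2 := h42
    tfae_have 4 → 7 := fun h => h ⟨⟨C, hclosed⟩, hne, hconv⟩
      (Metric.hausdorffEDist_self.trans_lt ENNReal.zero_lt_top)
    tfae_have 7 → 8 := fun h hinf => h (hinf.isPositivelyHiding hne)
    tfae_have 8 → 2 := (polyhedral_or_isInfinitelyHiding hne hclosed hconv
      (isCompact_dualSphere_of_finiteDimensional _)).resolve_right
    tfae_finish
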